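/- Let $\mathbb T$ be $\mathbb N_0$ or $[0,\infty)$ under addition (any commutative additive monoid will do), let $S$ be a set, and let $\mathcal B\subseteq B(\mathcal H)$ be a unital $C^*$-algebra of operators on a complex Hilbert space $\mathcal H$, with $1_{\mathcal B}=I_{\mathcal H}$. Inner products are linear in the second variable. A kernel $\mathfrak L:S\times S\to B(\mathcal B)$ with values in the bounded linear maps on $\mathcal B$ is a *CPD-kernel* if $\sum_{i,j} b_j^*\,\mathfrak L^{\sigma_j,\sigma_i}(a_j^*a_i)\,b_i\ge 0$ for all finite families $\sigma_i\in S$, $a_i,b_i\in\mathcal B$. Let $\mathfrak K=(\mathfrak K_t)_{t\in\mathbb T}$ be a semigroup of CPD-kernels: each $\mathfrak K_t$ is a CPD-kernel over $S$ on $\mathcal B$, and $\mathfrak K_s^{\sigma,\sigma'}\circ\mathfrak K_r^{\sigma,\sigma'}=\mathfrak K_{s+r}^{\sigma,\sigma'}$. For each $t$ let $(F_t,\eta_t)$ be a minimal Kolmogorov representation of $\mathfrak K_t$: $F_t$ is a Hilbert $\mathcal B$-$\mathcal B$-module and $\eta_t:S\to F_t$, $\sigma\mapsto\eta_t^\sigma$,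 satisfies $\mathfrak K_t^{\sigma,\sigma'}(b)=\langle\eta_t^\sigma,b\,\eta_t^{\sigma'}\rangle$ and $F_t=\overline{\mathrm{span}}\{a\,\eta_t^\sigma b: a,b\in\mathcal B,\ \sigma\in S\}$. Write $\odot$ for interior tensor products, $\langle x\odot y,x'\odot y'\rangle=\langle y,\langle x,x'\rangle y'\rangle$. Put $K_t=F_t\odot\mathcal H$, $\rho_t(b)=b\odot I_{\mathcal H}$ for $b\in\mathcal B$, and $L_{\eta_t^\sigma}:\mathcal H\to K_t$, $h\mapsto\eta_t^\sigma\odot h$. Let $E$ be a Hilbert $\mathcal B$-module and let $\mathcal K_t^\sigma:E\to E$ ($t\in\mathbb T$, $\sigma\in S$) be linear maps forming a $\mathfrak K$-family: $\mathfrak K_t^{\sigma,\sigma'}(\langle y,x\rangle)=\langle\mathcal K_t^\sigma(y),\mathcal K_t^{\sigma'}(x)\rangle$ for all $t,\sigma,\sigma',x,y$. Put $G_t=E\odot K_t$ and $\xi_t:E\to B(K_t,G_t)$, $\xi_t(x)k=x\odot k$; put $L=E\odot\mathcal H$ and $\chi:E\to B(\mathcal H,L)$, $\chi(x)h=x\odot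 h$. For a representation $\rho$ of $\mathcal B$ on a Hilbert space $K$, call $\xi:E\to B(K,G)$ *a representation of $E$ induced by $\rho$* if it is linear, $\xi(xb)=\xi(x)\rho(b)$, $\xi(x)^*\xi(y)=\rho(\langle x,y\rangle)$ and $\overline{\mathrm{span}}\,\xi(E)K=G$. Then: 1. For every $t$, $(K_t,\rho_t,(L_{\eta_t^\sigma})_\sigma)$ is a minimal Kolmogorov–Stinespring representation of $\mathfrak K_t$, i.e. $\rho_t$ is a unital $*$-representation, $L_{\eta_t^\sigma}^*\rho_t(b)L_{\eta_t^{\sigma'}}=\mathfrak K_t^{\sigma,\sigma'}(b)$ and $\overline{\mathrm{span}}\{\rho_t(b)L_{\eta_t^\sigma}h\}=K_t$. It is the only one up to unitary equivalence: for any other triple $(K',\rho',(L'_\sigma)_\sigma)$ with these properties there is exactly one unitary $U:K_t\to K'$ with $UL_{\eta_t^\sigma}=L'_\sigma$ for all $\sigma$ and $U\rho_t(b)=\rho'(b)U$ for all $b$. 2. For every $t$, $\xi_t$ is a representation of $E$ induced by $\rho_t$, and for any other representation $\xi':E\to B(K_t,G')$ of $E$ induced by $\rho_t$ there is exactly one unitary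 $U:G_t\to G'$ with $U\xi_t(x)=\xi'(x)$ for all $x\in E$. Also, $\chi$ is a representation of $E$ induced by the inclusion $\mathcal B\hookrightarrow B(\mathcal H)$. 3. There are $\mathcal B$-linear, inner product preserving maps $v_t:E\odot F_t\to E$ with $v_t(x\odot\eta_t^\sigma)=\mathcal K_t^\sigma(x)$, and Hilbert space isometries $V_t=v_t\odot I_{\mathcal H}:G_t=E\odot F_t\odot\mathcal H\to L=E\odot\mathcal H$ such that $$V_t\,\xi_t(x)\,L_{\eta_t^\sigma}=\chi(\mathcal K_t^\sigma(x))\qquad(t\in\mathbb T,\ \sigma\in S,\ x\in E).$$ For each $t$, $V_t$ is the only bounded operator $G_t\to L$ with this property. For all $s,t\in\mathbb T$ one has $V_{s+t}\,\xi_{s+t}(x)\,L_{\eta_{s+t}^\sigma}=\chi(\mathcal K_{s+t}^\sigma(x))$, and if $\mathcal K_{s+t}^\sigma=\mathcal K_s^\sigma\circ\mathcal K_t^\sigma$ for all $\sigma$, then this operator also equals $V_s\,\xi_s\bigl(v_t(x\odot\eta_t^\sigma)\bigr)\,L_{\eta_s^\sigma}$. -/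

import Mathlib

open MulOpposite UniformSpace
open scoped TensorProduct InnerProductSpace ComplexOrder

set_option linter.unusedSectionVars false

noncomputable section

/-- A (semi-)inner product right module over the C⋆-algebra `B`. The right action is
`x • b = op b • x`; the `B`-valued inner product is linear in the second variable and satisfies
`⟨x, y b⟩ = ⟨x, y⟩ b`, and the norm is `‖x‖ = ‖⟨x, x⟩‖ ^ (1/2)`. On a `NormedAddCommGroup` that is
complete this is a Hilbert `B`-module. (The class `CStarModule` of Mathlib has the mirrored
convention `⟨x, b • y⟩ = b ⟨x, y⟩`.) -/
class HilbertModule (B E : Type*) [CStarAlgebra B] [PartialOrder B]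
    [SeminormedAddCommGroup E] [NormedSpace ℂ E] [Module Bᵐᵒᵖ E] extends Inner B E where
  inner_add_right (x y z : E) : inner x (y + z) = inner x y + inner x z
  inner_smul_right (c : ℂ) (x y : E) : inner x (c • y) = c • inner x y
  inner_op_smul_right (b : B) (x y : E) : inner x (op b • y) = inner x y * b
  star_inner (x y : E) : star (inner x y) = inner y x
  inner_self_nonneg (x : E) : 0 ≤ inner x x
  norm_eq (x : E) : ‖x‖ = √‖inner x x‖

/-- The inner product module `F` over `B` together with a (unital) left action of `A` by adjointable
operators. -/
class IsHilbertBimodule (A B F : Type*) [CStarAlgebra A] [CStarAlgebra B] [PartialOrder B]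
    [SeminormedAddCommGroup F] [NormedSpace ℂ F] [Module Bᵐᵒᵖ F] [HilbertModule B F]
    [Module A F] : Prop extends IsScalarTower ℂ A F where
  inner_smul_left (a : A) (x y : F) : inner B (a • x) y = inner B x (star a • y)

namespace HilbertModule

section basic

variable {B E : Type*} [CStarAlgebra B] [PartialOrder B]
  [SeminormedAddCommGroup E] [NormedSpace ℂ E] [Module Bᵐᵒᵖ E] [HilbertModule B E]

theorem inner_add_left (x y z : E) : inner B (x + y) z = inner B x z + inner B y z := by
  rw [← star_inner, inner_add_right, star_add, star_inner, star_inner]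

theorem inner_smul_left (c : ℂ) (x y : E) : inner B (c • x) y = star c • inner B x y := by
  rw [← star_inner, inner_smul_right, star_smul, star_inner]

theorem inner_op_smul_left (b : B) (x y : E) :
    inner B (op b • x) y = star b * inner B x y := by
  rw [← star_inner, inner_op_smul_right, star_mul, star_inner]

variable (B E) in
/-- The inner product as a sesquilinear map. -/
def form : E →ₗ⋆[ℂ] E →ₗ[ℂ] B :=
  LinearMap.mk₂'ₛₗ (starRingEnd ℂ) (RingHom.id ℂ) (fun x y => inner B x y)
    inner_add_left inner_smul_left inner_add_right inner_smul_right

theorem form_apply (x y : E) : form B E x y = inner B x y := rfl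

theorem norm_sq_eq (x : E) : ‖x‖ ^ 2 = ‖inner B x x‖ := by
  rw [norm_eq (B := B), Real.sq_sqrt (norm_nonneg _)]

end basic

end HilbertModule

section gram

/-- The decomposition into positive and negative parts, phrased without an order. -/
theorem exists_negPart_aux {A : Type*} [CStarAlgebra A] (a : A) (ha : IsSelfAdjoint a) :
    ∃ n r : A, star n = n ∧ n * a = -(n * n) ∧ n = star r * r ∧
      (n = 0 → ∃ c : A, a = star c * c) := by
  let _ := CStarAlgebra.spectralOrder A
  have _ := CStarAlgebra.spectralOrderedRing A
  have hN0 : 0 ≤ a⁻ := CFC.negPart_nonneg a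
  obtain ⟨r, hr⟩ := CStarAlgebra.nonneg_iff_eq_star_mul_self.mp hN0
  refine ⟨a⁻, r, (IsSelfAdjoint.of_nonneg hN0).star_eq, ?_, hr, fun h => ?_⟩
  · have h1 : a⁻ * (a⁺ - a⁻) = -(a⁻ * a⁻) := by
      rw [mul_sub, CFC.negPart_mul_posPart, zero_sub]
    rwa [CFC.posPart_sub_negPart a ha] at h1
  · obtain ⟨c, hc⟩ := CStarAlgebra.nonneg_iff_eq_star_mul_self.mp (CFC.posPart_nonneg a)
    refine ⟨c, ?_⟩
    have h1 := CFC.posPart_sub_negPart a ha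
    rw [h, sub_zero] at h1
    rw [← hc, h1]

open HilbertModule

variable {B E : Type*} [CStarAlgebra B] [PartialOrder B] [StarOrderedRing B]
  [SeminormedAddCommGroup E] [NormedSpace ℂ E] [Module Bᵐᵒᵖ E] [HilbertModule B E]

/-- A Gram matrix is of the form `C⋆ C`. -/
theorem HilbertModule.exists_gram_factor {ι : Type*} [Fintype ι] (e : ι → E) :
    ∃ C : ι → ι → B, ∀ i j, inner B (e i) (e j) = ∑ m, star (C m i) * C m j := by
  classical
  let G : CStarMatrix ι ι B := CStarMatrix.ofMatrix (fun i j => inner B (e i) (e j))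
  have hG : ∀ i j, G i j = inner B (e i) (e j) := fun i j => rfl
  have hsa : IsSelfAdjoint G := by
    ext i j
    simp [CStarMatrix.star_apply, hG, star_inner]
  have hpos : ∀ (M : CStarMatrix ι ι B) (k : ι), 0 ≤ (star M * G * M) k k := by
    intro M k
    have : (star M * G * M) k k =
        inner B (∑ i, op (M i k) • e i) (∑ i, op (M i k) • e i) := by
      simp only [← form_apply, map_sum, LinearMap.sum_apply]
      simp only [form_apply, inner_op_smul_left, inner_op_smul_right, CStarMatrix.mul_apply,
        CStarMatrix.star_apply, hG, Finset.sum_mul]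
    rw [this]
    exact inner_self_nonneg _
  obtain ⟨N, R, hNsa, hNG, hR, hfin⟩ := exists_negPart_aux G hsa
  -- `N * N * N = star (R * N) * (R * N)` has vanishing diagonal.
  have key : R * N = 0 := by
    have h1 : star N * G * N = -(star (R * N) * (R * N)) := by
      rw [hNsa, hNG, star_mul, hNsa]
      have : N * star R * (R * N) = N * N * N := by
        rw [mul_assoc, ← mul_assoc (star R), ← hR, mul_assoc]
      rw [this, neg_mul]
    have h2 : ∀ k, (∑ m, star ((R * N) m k) * (R * N) m k) = 0 := by
      intro k
      have h3 := hpos N k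
      rw [h1] at h3
      have h4 : (-(star (R * N) * (R * N))) k k
          = -∑ m, star ((R * N) m k) * (R * N) m k := by
        rw [CStarMatrix.neg_apply, CStarMatrix.mul_apply]
        simp only [CStarMatrix.star_apply]
      rw [h4] at h3
      refine le_antisymm (by simpa using h3) (Finset.sum_nonneg fun m _ => star_mul_self_nonneg _)
    ext m k
    have := (Finset.sum_eq_zero_iff_of_nonneg
      (fun m _ => star_mul_self_nonneg ((R * N) m k))).mp (h2 k) m (Finset.mem_univ _)
    simpa using CStarRing.star_mul_self_eq_zero_iff _ |>.mp this
  have hNN : N * N = 0 := by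
    conv_lhs => lhs; rw [hR]
    rw [mul_assoc, key, mul_zero]
  have hN : N = 0 := by
    have : star N * N = 0 := by rw [hNsa, hNN]
    exact CStarRing.star_mul_self_eq_zero_iff _ |>.mp this
  obtain ⟨C, hC⟩ := hfin hN
  refine ⟨fun i j => C i j, fun i j => ?_⟩
  rw [← hG, hC, CStarMatrix.mul_apply]
  simp only [CStarMatrix.star_apply]

end gram

namespace HilbertModule

section norm

variable {B E : Type*} [CStarAlgebra B] [PartialOrder B]
  [SeminormedAddCommGroup E] [NormedSpace ℂ E] [Module Bᵐᵒᵖ E] [HilbertModule B E]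

/-- `‖x b‖ ≤ ‖b‖ ‖x‖`. -/
theorem norm_op_smul_le (b : Bᵐᵒᵖ) (x : E) : ‖b • x‖ ≤ ‖b‖ * ‖x‖ := by
  induction b using MulOpposite.rec' with | _ b
  rw [norm_eq (B := B) (op b • x), norm_eq (B := B) x, inner_op_smul_left, inner_op_smul_right,
    MulOpposite.norm_op, Real.sqrt_le_left (by positivity), mul_pow, Real.sq_sqrt (norm_nonneg _)]
  calc ‖star b * (inner B x x * b)‖ ≤ ‖star b‖ * (‖inner B x x‖ * ‖b‖) :=
        (norm_mul_le _ _).trans (by gcongr; exact norm_mul_le _ _)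
    _ = ‖b‖ ^ 2 * ‖inner B x x‖ := by rw [norm_star]; ring

end norm

end HilbertModule

section preform
/-! ### Semi-inner products on algebraic interior tensor products -/

variable {B E N D : Type*} [CStarAlgebra B] [PartialOrder B]
  [SeminormedAddCommGroup E] [NormedSpace ℂ E] [Module Bᵐᵒᵖ E] [HilbertModule B E]
  [AddCommGroup N] [Module ℂ N]

section
variable [AddCommGroup D] [Module ℂ D]

/-- For a left action `l` of `B` on `N` and a sesquilinear form `β` on `N`, the form
`⟨x ⊙ y, x' ⊙ y'⟩ = β (y, ⟨x, x'⟩ y')`, where `x ⊙ y` is written `y ⊗ₜ x`. -/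
def tensorForm (l : B →ₐ[ℂ] Module.End ℂ N) (β : N →ₗ⋆[ℂ] N →ₗ[ℂ] D) :
    (N ⊗[ℂ] E) →ₗ⋆[ℂ] (N ⊗[ℂ] E) →ₗ[ℂ] D :=
  TensorProduct.lift <| LinearMap.mk₂'ₛₗ (starRingEnd ℂ) (starRingEnd ℂ)
    (fun y x => TensorProduct.lift <| LinearMap.mk₂ ℂ (fun y' x' => β y (l (inner B x x') y'))
      (by intros; simp only [map_add])
      (by intros; simp only [map_smul])
      (by intros; simp only [HilbertModule.inner_add_right, map_add, LinearMap.add_apply])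
      (by intros; simp only [HilbertModule.inner_smul_right, map_smul, LinearMap.smul_apply]))
    (by intros; ext; simp)
    (by intros; ext; simp)
    (by intros; ext; simp [HilbertModule.inner_add_left])
    (by intros; ext; simp [HilbertModule.inner_smul_left])

theorem tensorForm_tmul (l : B →ₐ[ℂ] Module.End ℂ N) (β : N →ₗ⋆[ℂ] N →ₗ[ℂ] D)
    (y y' : N) (x x' : E) :
    tensorForm l β (y ⊗ₜ x) (y' ⊗ₜ x') = β y (l (inner B x x') y') := rfl

end

theorem tensorForm_star [AddCommGroup D] [Module ℂ D] [StarAddMonoid D]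
    (l : B →ₐ[ℂ] Module.End ℂ N) (β : N →ₗ⋆[ℂ] N →ₗ[ℂ] D)
    (hstar : ∀ y y', star (β y y') = β y' y)
    (hadj : ∀ b y y', β (l b y) y' = β y (l (star b) y')) (z w : N ⊗[ℂ] E) :
    star (tensorForm l β z w) = tensorForm l β w z := by
  induction z with
  | zero => simp
  | add z z' h h' => simp [h, h']
  | tmul y x =>
    induction w with
    | zero => simp
    | add w w' h h' => simp [h, h']
    | tmul y' x' => simp [tensorForm_tmul, hstar, hadj, HilbertModule.star_inner]

theorem tensorForm_nonneg [StarOrderedRing B] [AddCommGroup D] [Module ℂ D] [PartialOrder D] [IsOrderedAddMonoid D]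
    (l : B →ₐ[ℂ] Module.End ℂ N) (β : N →ₗ⋆[ℂ] N →ₗ[ℂ] D)
    (hpos : ∀ y, 0 ≤ β y y)
    (hadj : ∀ b y y', β (l b y) y' = β y (l (star b) y')) (z : N ⊗[ℂ] E) :
    0 ≤ tensorForm l β z z := by
  obtain ⟨s, hs⟩ := TensorProduct.exists_finset z
  obtain ⟨C, hC⟩ := HilbertModule.exists_gram_factor (B := B) (fun i : s => i.1.2)
  have hz : z = ∑ i : s, i.1.1 ⊗ₜ[ℂ] i.1.2 := by
    rw [hs, Finset.sum_coe_sort s (fun i => i.1 ⊗ₜ[ℂ] i.2)]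
  have : tensorForm l β z z = ∑ m, β (∑ i : s, l (C m i) i.1.1) (∑ i : s, l (C m i) i.1.1) := by
    rw [hz]
    simp only [map_sum, LinearMap.sum_apply, tensorForm_tmul, hC, map_mul, Module.End.mul_apply,
      hadj]
    exact (Finset.sum_congr rfl fun x _ => Finset.sum_comm).trans Finset.sum_comm
  rw [this]
  exact Finset.sum_nonneg fun m _ => hpos _

theorem tensorForm_lTensor [AddCommGroup D] [Module ℂ D]
    (l : B →ₐ[ℂ] Module.End ℂ N) (β : N →ₗ⋆[ℂ] N →ₗ[ℂ] D)
    (P Q : E →ₗ[ℂ] E) (hPQ : ∀ x x', inner B (P x) x' = inner B x (Q x')) (z w : N ⊗[ℂ] E) :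
    tensorForm l β (P.lTensor N z) w = tensorForm l β z (Q.lTensor N w) := by
  induction z with
  | zero => simp
  | add z z' h h' => simp only [map_add, LinearMap.add_apply, h, h']
  | tmul y x =>
    induction w with
    | zero => simp
    | add w w' h h' => simp only [map_add, h, h']
    | tmul y' x' => simp only [LinearMap.lTensor_tmul, tensorForm_tmul, hPQ]

end preform

section cauchySchwarz

/-- The Cauchy-Schwarz inequality for algebra valued semi-inner products. -/
theorem semiInner_norm_sq_le {C X : Type*} [CStarAlgebra C] [PartialOrder C] [StarOrderedRing C]
    [AddCommGroup X] [Module ℂ X] [Module Cᵐᵒᵖ X] (Φ : X →ₗ⋆[ℂ] X →ₗ[ℂ] C)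
    (hstar : ∀ x y, star (Φ x y) = Φ y x) (hpos : ∀ x, 0 ≤ Φ x x)
    (hop : ∀ (c : C) x y, Φ x (op c • y) = Φ x y * c) (x y : X) :
    ‖Φ x y‖ ^ 2 ≤ ‖Φ x x‖ * ‖Φ y y‖ := by
  have hop' : ∀ (c : C) x y, Φ (op c • x) y = star c * Φ x y := fun c x y => by
    rw [← hstar, hop, star_mul, hstar]
  have main : ∀ c : ℝ, 0 < c → ‖Φ x x‖ ≤ c → ‖Φ x y‖ ^ 2 ≤ c * ‖Φ y y‖ := by
    intro c hc hxc
    set a := Φ x y with ha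
    have ha' : Φ y x = star a := by rw [ha, hstar]
    have h1 : Φ ((c : ℂ) • y - op a • x) ((c : ℂ) • y - op a • x)
        = c • (c • Φ y y) - c • (star a * a) - c • (star a * a) + star a * Φ x x * a := by
      have e1 : ∀ u v, Φ u ((c : ℂ) • v) = c • Φ u v := fun u v => by
        rw [map_smul, Complex.coe_smul]
      have e2 : ∀ u v, Φ ((c : ℂ) • u) v = c • Φ u v := fun u v => by
        rw [LinearMap.map_smulₛₗ, LinearMap.smul_apply, Complex.conj_ofReal, Complex.coe_smul]
      simp only [map_sub, LinearMap.sub_apply, e1, e2, hop, hop', ha', ← ha, mul_assoc]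
      abel
    have h2 : star a * Φ x x * a ≤ c • (star a * a) :=
      (CStarAlgebra.star_left_conjugate_le_norm_smul (IsSelfAdjoint.of_nonneg (hpos x))).trans
        (smul_le_smul_of_nonneg_right hxc (star_mul_self_nonneg a))
    have h3 : c • (star a * a) ≤ c • (c • Φ y y) := by
      have h4 := hpos ((c : ℂ) • y - op a • x)
      rw [h1] at h4
      have h5 := h4.trans (add_le_add_right h2 _)
      simpa using h5
    have h6 : star a * a ≤ c • Φ y y := by
      have := smul_le_smul_of_nonneg_left h3 (inv_nonneg.mpr hc.le)
      rwa [inv_smul_smul₀ hc.ne', inv_smul_smul₀ hc.ne'] at this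
    calc ‖a‖ ^ 2 = ‖star a * a‖ := by rw [CStarRing.norm_star_mul_self, sq]
      _ ≤ ‖c • Φ y y‖ := CStarAlgebra.norm_le_norm_of_nonneg_of_le (star_mul_self_nonneg a) h6
      _ = c * ‖Φ y y‖ := by rw [norm_smul, Real.norm_of_nonneg hc.le]
  refine le_of_forall_pos_le_add fun ε hε => ?_
  have hd : 0 < ε / (‖Φ y y‖ + 1) := by positivity
  refine (main (‖Φ x x‖ + ε / (‖Φ y y‖ + 1)) (by positivity) (by linarith)).trans ?_
  rw [add_mul]
  gcongr
  rw [div_mul_eq_mul_div, div_le_iff₀ (by positivity)]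
  nlinarith [norm_nonneg (Φ y y)]

/-- The seminorm `√‖Φ x x‖`. -/
abbrev semiInnerSeminormedAddCommGroup {C X : Type*} [CStarAlgebra C] [PartialOrder C]
    [StarOrderedRing C] [AddCommGroup X] [Module ℂ X] [Module Cᵐᵒᵖ X] (Φ : X →ₗ⋆[ℂ] X →ₗ[ℂ] C)
    (hstar : ∀ x y, star (Φ x y) = Φ y x) (hpos : ∀ x, 0 ≤ Φ x x)
    (hop : ∀ (c : C) x y, Φ x (op c • y) = Φ x y * c) : SeminormedAddCommGroup X :=
  AddGroupSeminorm.toSeminormedAddCommGroup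
    { toFun := fun x => √‖Φ x x‖
      map_zero' := by simp
      neg' := fun x => by simp
      add_le' := fun x y => by
        have hxy : ‖Φ x y‖ ≤ √‖Φ x x‖ * √‖Φ y y‖ := by
          rw [← Real.sqrt_mul (norm_nonneg _)]
          exact Real.le_sqrt_of_sq_le (semiInner_norm_sq_le Φ hstar hpos hop x y)
        have hyx : ‖Φ y x‖ ≤ √‖Φ x x‖ * √‖Φ y y‖ := by rwa [← hstar, norm_star]
        rw [Real.sqrt_le_left (by positivity), add_sq, Real.sq_sqrt (norm_nonneg _),
          Real.sq_sqrt (norm_nonneg _)]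
        simp only [map_add, LinearMap.add_apply]
        have := norm_add₄_le (a := Φ x x) (b := Φ y x) (c := Φ x y) (d := Φ y y)
        rw [← add_assoc]
        linarith }

end cauchySchwarz

namespace HilbertModule

section completion
/-! ### Completion of a semi-inner product module -/

variable {B E : Type*} [CStarAlgebra B] [PartialOrder B] [StarOrderedRing B]

section semi
variable [SeminormedAddCommGroup E] [NormedSpace ℂ E] [Module Bᵐᵒᵖ E] [HilbertModule B E]

theorem norm_inner_le (x y : E) : ‖inner B x y‖ ≤ ‖x‖ * ‖y‖ := by
  rw [norm_eq (B := B) x, norm_eq (B := B) y, ← Real.sqrt_mul (norm_nonneg _)]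
  exact Real.le_sqrt_of_sq_le (semiInner_norm_sq_le (form B E) star_inner inner_self_nonneg
    inner_op_smul_right x y)

variable (B E) in
theorem uniformContinuousConstSMul : UniformContinuousConstSMul Bᵐᵒᵖ E where
  uniformContinuous_const_smul b := by
    let f : E →+ E := DistribSMul.toAddMonoidHom E b
    exact (AddMonoidHomClass.lipschitz_of_bound f ‖b‖ (norm_op_smul_le b)).uniformContinuous

variable (B E) in
theorem continuous_inner : Continuous (fun p : E × E => inner B p.1 p.2) := by
  let F := (form B E).mkContinuous₂ 1 fun x y => by
    simpa [form_apply] using norm_inner_le (B := B) x y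
  exact (F.continuous.comp continuous_fst).clm_apply continuous_snd

/-- The `B`-valued inner product and the right action of `B` extend to the completion. -/
instance completionModule : Module Bᵐᵒᵖ (Completion E) :=
  letI := uniformContinuousConstSMul B E
  inferInstance

theorem coe_op_smul (b : Bᵐᵒᵖ) (x : E) : ((b • x : E) : Completion E) = b • (x : Completion E) :=
  letI := uniformContinuousConstSMul B E
  Completion.coe_smul b x

theorem completion_inner_coe (x y : E) :
    inner B (x : Completion E) (y : Completion E) = inner B x y :=
  (Completion.isDenseInducing_coe.prodMap Completion.isDenseInducing_coe).extend_eq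
    (continuous_inner B E) (x, y)

theorem completion_continuous_inner :
    Continuous (fun p : Completion E × Completion E => inner B p.1 p.2) := by
  let i : E →+ E →+ B := AddMonoidHom.mk' (fun x => (form B E x).toAddMonoidHom)
    (fun x y => by ext z; simp)
  have h : Continuous fun p : E × E => i p.1 p.2 := continuous_inner B E
  exact (Completion.isDenseInducing_toCompl E).extend_Z_bilin
    (Completion.isDenseInducing_toCompl E) h

theorem continuous_inner_comp {α : Type*} [TopologicalSpace α] {f g : α → Completion E}
    (hf : Continuous f) (hg : Continuous g) : Continuous fun a => inner B (f a) (g a) :=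
  completion_continuous_inner.comp (hf.prodMk hg)

instance completion : HilbertModule B (Completion E) where
  inner_add_right x y z := by
    refine Completion.induction_on₃ x y z (isClosed_eq ?_ ?_) fun a b c => ?_
    · exact continuous_inner_comp continuous_fst
        ((continuous_fst.comp continuous_snd).add (continuous_snd.comp continuous_snd))
    · exact (continuous_inner_comp continuous_fst (continuous_fst.comp continuous_snd)).add
        (continuous_inner_comp continuous_fst (continuous_snd.comp continuous_snd))
    · rw [← Completion.coe_add, completion_inner_coe, completion_inner_coe, completion_inner_coe,
        inner_add_right]
  inner_smul_right c x y := by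
    refine Completion.induction_on₂ x y (isClosed_eq ?_ ?_) fun a b => ?_
    · exact continuous_inner_comp continuous_fst (continuous_snd.const_smul c)
    · exact (continuous_inner_comp continuous_fst continuous_snd).const_smul c
    · rw [← Completion.coe_smul, completion_inner_coe, completion_inner_coe, inner_smul_right]
  inner_op_smul_right c x y := by
    have := uniformContinuousConstSMul B E
    refine Completion.induction_on₂ x y (isClosed_eq ?_ ?_) fun a b => ?_
    · exact continuous_inner_comp continuous_fst (continuous_snd.const_smul (op c))
    · exact (continuous_inner_comp continuous_fst continuous_snd).mul continuous_const
    · rw [← coe_op_smul, completion_inner_coe, completion_inner_coe, inner_op_smul_right]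
  star_inner x y := by
    refine Completion.induction_on₂ x y (isClosed_eq ?_ ?_) fun a b => ?_
    · exact (continuous_inner_comp continuous_fst continuous_snd).star
    · exact continuous_inner_comp continuous_snd continuous_fst
    · rw [completion_inner_coe, completion_inner_coe, star_inner]
  inner_self_nonneg x := by
    refine Completion.induction_on x (isClosed_le continuous_const ?_) fun a => ?_
    · exact continuous_inner_comp continuous_id continuous_id
    · rw [completion_inner_coe]
      exact inner_self_nonneg a
  norm_eq x := by
    refine Completion.induction_on x (isClosed_eq continuous_norm ?_) fun a => ?_
    · exact (continuous_inner_comp continuous_id continuous_id).norm.sqrt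
    · rw [completion_inner_coe, Completion.norm_coe, norm_eq (B := B)]

end semi

section normed
variable [NormedAddCommGroup E] [NormedSpace ℂ E] [Module Bᵐᵒᵖ E] [HilbertModule B E]

theorem ext_inner {x y : E} (h : ∀ z : E, inner B z x = inner B z y) : x = y := by
  have h1 : inner B (x - y) (x - y) = 0 := by
    rw [← form_apply, map_sub, form_apply, form_apply, h, sub_self]
  have h2 := norm_eq (B := B) (x - y)
  rw [h1, norm_zero, Real.sqrt_zero, norm_eq_zero] at h2
  exact sub_eq_zero.mp h2

variable (B E) in
theorem smulCommClass : SMulCommClass ℂ Bᵐᵒᵖ E where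
  smul_comm c b x := by
    induction b using MulOpposite.rec' with | _ b
    refine ext_inner (B := B) fun z => ?_
    simp only [inner_smul_right, inner_op_smul_right, smul_mul_assoc]

end normed

end completion

end HilbertModule

section interior
/-! ### The interior tensor product `E ⊙ F` of Hilbert modules -/

variable (B C E F : Type*) [CStarAlgebra B] [PartialOrder B] [StarOrderedRing B]
  [CStarAlgebra C] [PartialOrder C] [StarOrderedRing C]
  [NormedAddCommGroup E] [NormedSpace ℂ E] [Module Bᵐᵒᵖ E] [HilbertModule B E]
  [NormedAddCommGroup F] [NormedSpace ℂ F] [Module Cᵐᵒᵖ F] [HilbertModule C F]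
  [Module B F] [IsHilbertBimodule B C F]

/-- The algebraic tensor product of `E` and `F`, with the semi-inner product
`⟨x ⊙ y, x' ⊙ y'⟩ = ⟨y, ⟨x, x'⟩ y'⟩`. The factors are written in the opposite order. -/
@[nolint unusedArguments]
def PreInteriorTensor (_ _ E F : Type*) [NormedAddCommGroup E] [NormedSpace ℂ E]
    [NormedAddCommGroup F] [NormedSpace ℂ F] : Type _ := F ⊗[ℂ] E

namespace PreInteriorTensor

instance : AddCommGroup (PreInteriorTensor B C E F) := inferInstanceAs (AddCommGroup (F ⊗[ℂ] E))

instance : Module ℂ (PreInteriorTensor B C E F) := inferInstanceAs (Module ℂ (F ⊗[ℂ] E))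

instance : Module Cᵐᵒᵖ (PreInteriorTensor B C E F) :=
  letI := HilbertModule.smulCommClass C F
  inferInstanceAs (Module Cᵐᵒᵖ (F ⊗[ℂ] E))

variable {E F} in
/-- The elementary tensor `x ⊙ y`. -/
def tmul (x : E) (y : F) : PreInteriorTensor B C E F := (y ⊗ₜ[ℂ] x : F ⊗[ℂ] E)

/-- The left action of `B` on `F`. -/
def leftAction : B →ₐ[ℂ] Module.End ℂ F :=
  haveI := IsHilbertBimodule.toIsScalarTower (A := B) (B := C) (F := F)
  Algebra.lsmul ℂ ℂ F

/-- The semi-inner product. -/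
def form : PreInteriorTensor B C E F →ₗ⋆[ℂ] PreInteriorTensor B C E F →ₗ[ℂ] C :=
  tensorForm (B := B) (E := E) (N := F) (leftAction B C F) (HilbertModule.form C F)

theorem star_form (z w : PreInteriorTensor B C E F) :
    star (form B C E F z w) = form B C E F w z :=
  tensorForm_star _ _ HilbertModule.star_inner
    IsHilbertBimodule.inner_smul_left z w

theorem form_self_nonneg (z : PreInteriorTensor B C E F) : 0 ≤ form B C E F z z :=
  tensorForm_nonneg _ _ HilbertModule.inner_self_nonneg
    IsHilbertBimodule.inner_smul_left z

theorem form_op_smul (c : C) (z w : PreInteriorTensor B C E F) :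
    form B C E F z (op c • w) = form B C E F z w * c := by
  have := HilbertModule.smulCommClass C F
  change F ⊗[ℂ] E at z w
  change tensorForm (leftAction B C F) (HilbertModule.form C F) z (op c • w)
    = tensorForm (leftAction B C F) (HilbertModule.form C F) z w * c
  induction z with
  | zero => simp
  | add z z' h h' => simp only [map_add, LinearMap.add_apply, h, h', add_mul]
  | tmul y x =>
    induction w with
    | zero => simp
    | add w w' h h' => simp only [map_add, smul_add, h, h', add_mul]
    | tmul y' x' =>
      rw [TensorProduct.smul_tmul', tensorForm_tmul, tensorForm_tmul]
      change inner C y (inner B x x' • (op c • y')) = inner C y (inner B x x' • y') * c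
      have h : ∀ (b : B) (u v : F), inner C u (b • v) = inner C (star b • u) v := fun b u v => by
        rw [IsHilbertBimodule.inner_smul_left, star_star]
      rw [h, h, HilbertModule.inner_op_smul_right]

instance : SeminormedAddCommGroup (PreInteriorTensor B C E F) :=
  semiInnerSeminormedAddCommGroup (form B C E F) (star_form B C E F) (form_self_nonneg B C E F)
    (form_op_smul B C E F)

theorem norm_def (z : PreInteriorTensor B C E F) : ‖z‖ = √‖form B C E F z z‖ := rfl

instance : NormedSpace ℂ (PreInteriorTensor B C E F) where
  norm_smul_le c z := by
    rw [norm_def, norm_def, map_smul, LinearMap.map_smulₛₗ, LinearMap.smul_apply, norm_smul,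
      norm_smul, ← mul_assoc, Real.sqrt_mul (by positivity)]
    simp

instance : HilbertModule C (PreInteriorTensor B C E F) where
  inner z w := form B C E F z w
  inner_add_right _ _ _ := map_add _ _ _
  inner_smul_right _ _ _ := map_smul _ _ _
  inner_op_smul_right c z w := form_op_smul B C E F c z w
  star_inner := star_form B C E F
  inner_self_nonneg := form_self_nonneg B C E F
  norm_eq := norm_def B C E F

end PreInteriorTensor

/-- The interior tensor product `E ⊙ F`, a Hilbert `C`-module. -/
abbrev InteriorTensor : Type _ := Completion (PreInteriorTensor B C E F)

variable {E F} in
/-- The elementary tensor `x ⊙ y`. -/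
def InteriorTensor.tmul (x : E) (y : F) : InteriorTensor B C E F :=
  Completion.coe' (PreInteriorTensor.tmul B C x y)

variable {E F} in
theorem InteriorTensor.inner_tmul (x x' : E) (y y' : F) :
    inner C (tmul B C x y) (tmul B C x' y') = inner C y (inner B x x' • y') :=
  HilbertModule.completion_inner_coe _ _

end interior

section hilbert
/-! ### The Hilbert space `E ⊙ K` for a representation `ρ` of `B` on a Hilbert space `K` -/

variable {B K : Type*} [CStarAlgebra B] [PartialOrder B] [StarOrderedRing B]
  [NormedAddCommGroup K] [InnerProductSpace ℂ K] [CompleteSpace K]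
  (ρ : B →⋆ₐ[ℂ] (K →L[ℂ] K))
  (E : Type*) [NormedAddCommGroup E] [NormedSpace ℂ E] [Module Bᵐᵒᵖ E] [HilbertModule B E]

/-- The algebraic tensor product of `E` and `K`, with the semi-inner product
`⟨x ⊙ k, x' ⊙ k'⟩ = ⟨k, ρ ⟨x, x'⟩ k'⟩`. The factors are written in the opposite order. -/
@[nolint unusedArguments]
def PreHilbertTensor (_ : B →⋆ₐ[ℂ] (K →L[ℂ] K)) (E : Type*) [NormedAddCommGroup E]
    [NormedSpace ℂ E] : Type _ := K ⊗[ℂ] E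

namespace PreHilbertTensor

instance : AddCommGroup (PreHilbertTensor ρ E) := inferInstanceAs (AddCommGroup (K ⊗[ℂ] E))

instance : Module ℂ (PreHilbertTensor ρ E) := inferInstanceAs (Module ℂ (K ⊗[ℂ] E))

variable {E} in
/-- The elementary tensor `x ⊙ k`. -/
def tmul (x : E) (k : K) : PreHilbertTensor ρ E := (k ⊗ₜ[ℂ] x : K ⊗[ℂ] E)

/-- The left action of `B` on `K` as linear maps. -/
def leftAction : B →ₐ[ℂ] Module.End ℂ K where
  toFun b := (ρ b).toLinearMap
  map_one' := by ext; simp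
  map_mul' a b := by ext; simp
  map_zero' := by simp
  map_add' a b := by simp
  commutes' c := by ext; simp [Algebra.algebraMap_eq_smul_one]

theorem leftAction_adj (b : B) (k k' : K) :
    innerₛₗ ℂ (leftAction ρ b k) k' = innerₛₗ ℂ k (leftAction ρ (star b) k') := by
  change inner ℂ (ρ b k) k' = inner ℂ k (ρ (star b) k')
  rw [map_star, ContinuousLinearMap.star_eq_adjoint, ContinuousLinearMap.adjoint_inner_right]

/-- The semi-inner product. -/
def form : PreHilbertTensor ρ E →ₗ⋆[ℂ] PreHilbertTensor ρ E →ₗ[ℂ] ℂ :=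
  tensorForm (B := B) (E := E) (N := K) (leftAction ρ) (innerₛₗ ℂ)

theorem form_tmul (x x' : E) (k k' : K) :
    form ρ E (tmul ρ x k) (tmul ρ x' k') = inner ℂ k (ρ (inner B x x') k') := rfl

theorem star_form (z w : PreHilbertTensor ρ E) : star (form ρ E z w) = form ρ E w z :=
  tensorForm_star _ _ (fun k k' => inner_conj_symm k' k) (leftAction_adj ρ) z w

theorem form_self_nonneg (z : PreHilbertTensor ρ E) : 0 ≤ form ρ E z z :=
  tensorForm_nonneg _ _ (fun k => by
    change (0 : ℂ) ≤ inner ℂ k k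
    rw [inner_self_eq_norm_sq_to_K]
    exact pow_nonneg (RCLike.ofReal_nonneg.mpr (norm_nonneg k)) 2) (leftAction_adj ρ) z

/-- The semi-inner product space structure. -/
abbrev core : PreInnerProductSpace.Core ℂ (PreHilbertTensor ρ E) where
  inner z w := form ρ E z w
  conj_inner_symm z w := star_form ρ E w z
  re_inner_nonneg z := (Complex.nonneg_iff.mp (form_self_nonneg ρ E z)).1
  add_left z z' w := by rw [map_add, LinearMap.add_apply]
  smul_left z w c := by rw [LinearMap.map_smulₛₗ, LinearMap.smul_apply, smul_eq_mul]

instance : SeminormedAddCommGroup (PreHilbertTensor ρ E) :=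
  @InnerProductSpace.Core.toSeminormedAddCommGroup ℂ _ _ _ _ (core ρ E)

instance : InnerProductSpace ℂ (PreHilbertTensor ρ E) := InnerProductSpace.ofCore (core ρ E)

theorem inner_eq (z w : PreHilbertTensor ρ E) : inner ℂ z w = form ρ E z w := rfl

theorem norm_tmul_le (x : E) (k : K) : ‖tmul ρ x k‖ ≤ ‖x‖ * ‖k‖ := by
  refine (sq_le_sq₀ (norm_nonneg _) (by positivity)).mp ?_
  rw [← inner_self_eq_norm_sq (𝕜 := ℂ), inner_eq, form_tmul, mul_pow,
    HilbertModule.norm_sq_eq (B := B) x]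
  calc RCLike.re (inner ℂ k (ρ (inner B x x) k)) ≤ ‖inner ℂ k (ρ (inner B x x) k)‖ :=
        RCLike.re_le_norm _
    _ ≤ ‖k‖ * (‖ρ (inner B x x)‖ * ‖k‖) :=
        (_root_.norm_inner_le_norm _ _).trans (by gcongr; exact ContinuousLinearMap.le_opNorm _ _)
    _ ≤ ‖k‖ * (‖inner B x x‖ * ‖k‖) := by
        gcongr
        exact NonUnitalStarAlgHom.norm_apply_le ρ _
    _ = ‖inner B x x‖ * ‖k‖ ^ 2 := by ring

end PreHilbertTensor

/-- The interior tensor product `E ⊙ K`, a Hilbert space. -/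
abbrev HilbertTensor : Type _ := Completion (PreHilbertTensor ρ E)

namespace HilbertTensor

variable {E}

/-- The creation operator `L_x : K → E ⊙ K`, `k ↦ x ⊙ k`. -/
def creation (x : E) : K →L[ℂ] HilbertTensor ρ E :=
  LinearMap.mkContinuous
    { toFun := fun k => Completion.coe' (PreHilbertTensor.tmul ρ x k)
      map_add' := fun k k' => by
        rw [← Completion.coe_add]
        exact congrArg _ (TensorProduct.add_tmul k k' x)
      map_smul' := fun c k => by
        rw [RingHom.id_apply, ← Completion.coe_smul]
        exact congrArg _ (TensorProduct.smul_tmul' c k x).symm } ‖x‖ fun k => by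
    change ‖Completion.coe' (PreHilbertTensor.tmul ρ x k)‖ ≤ ‖x‖ * ‖k‖
    rw [Completion.norm_coe]
    exact PreHilbertTensor.norm_tmul_le ρ E x k

theorem inner_creation (x x' : E) (k k' : K) :
    inner ℂ (creation ρ x k) (creation ρ x' k') = inner ℂ k (ρ (inner B x x') k') :=
  Completion.inner_coe _ _

theorem dense_span_creation :
    (Submodule.span ℂ {z | ∃ (x : E) (k : K), creation ρ x k = z}).topologicalClosure = ⊤ := by
  rw [← Submodule.dense_iff_topologicalClosure_eq_top]
  refine (Completion.denseRange_coe (α := PreHilbertTensor ρ E)).mono ?_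
  rintro _ ⟨z, rfl⟩
  change K ⊗[ℂ] E at z
  induction z with
  | zero => exact Submodule.zero_mem (Submodule.span ℂ {z | ∃ (x : E) (k : K), creation ρ x k = z})
  | add z z' h h' =>
    rw [SetLike.mem_coe] at *
    have e := Completion.coe_add (α := PreHilbertTensor ρ E) z z'
    exact (congrArg (· ∈ Submodule.span ℂ {z | ∃ (x : E) (k : K), creation ρ x k = z}) e).mpr
      (Submodule.add_mem _ h h')
  | tmul k x => exact Submodule.subset_span ⟨x, k, rfl⟩

end HilbertTensor

end hilbert

section leftRep
/-! ### The Stinespring representation `a ↦ a ⊙ id` on `F ⊙ H` -/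

variable {B H : Type*} [CStarAlgebra B] [PartialOrder B] [StarOrderedRing B]
  [NormedAddCommGroup H] [InnerProductSpace ℂ H] [CompleteSpace H]
  (π : B →⋆ₐ[ℂ] (H →L[ℂ] H))
  (A F : Type*) [CStarAlgebra A]
  [NormedAddCommGroup F] [NormedSpace ℂ F] [Module Bᵐᵒᵖ F] [HilbertModule B F]
  [Module A F] [IsHilbertBimodule A B F]

namespace PreHilbertTensor

/-- The operator `a ⊙ id` on the algebraic tensor product. -/
def leftMul : A →ₐ[ℂ] Module.End ℂ (PreHilbertTensor π F) :=
  haveI := IsHilbertBimodule.toIsScalarTower (A := A) (B := B) (F := F)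
  ((Module.End.lTensorAlgHom ℂ F H).comp (Algebra.lsmul ℂ ℂ F) :
    A →ₐ[ℂ] Module.End ℂ (H ⊗[ℂ] F))

variable {A F} in
theorem leftMul_tmul (a : A) (y : F) (h : H) :
    leftMul (B := B) π A F a (tmul π y h) = tmul π (a • y) h := rfl

theorem form_leftMul (a : A) (z w : PreHilbertTensor π F) :
    form π F (leftMul (B := B) π A F a z) w
      = form π F z (leftMul (B := B) π A F (star a) w) := by
  have := IsHilbertBimodule.toIsScalarTower (A := A) (B := B) (F := F)
  exact tensorForm_lTensor _ _ (Algebra.lsmul ℂ ℂ F a) (Algebra.lsmul ℂ ℂ F (star a))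
    (IsHilbertBimodule.inner_smul_left (B := B) a) z w

theorem norm_leftMul_le (a : A) (z : PreHilbertTensor π F) :
    ‖leftMul (B := B) π A F a z‖ ≤ ‖a‖ * ‖z‖ := by
  let _ := CStarAlgebra.spectralOrder A
  have _ := CStarAlgebra.spectralOrderedRing A
  have h1 : 0 ≤ algebraMap ℝ A (‖a‖ ^ 2) - star a * a :=
    sub_nonneg.mpr CStarAlgebra.star_mul_le_algebraMap_norm_sq
  obtain ⟨c, hc⟩ := CStarAlgebra.nonneg_iff_eq_star_mul_self.mp h1
  have h2 := (core π F).re_inner_nonneg (leftMul (B := B) π A F c z)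
  change 0 ≤ RCLike.re (form π F _ _) at h2
  rw [form_leftMul, ← Module.End.mul_apply, ← map_mul, ← hc] at h2
  refine (sq_le_sq₀ (norm_nonneg _) (by positivity)).mp ?_
  rw [← inner_self_eq_norm_sq (𝕜 := ℂ), inner_eq, mul_pow, ← inner_self_eq_norm_sq (𝕜 := ℂ) z,
    inner_eq, form_leftMul, ← Module.End.mul_apply, ← map_mul]
  have h3 : leftMul (B := B) π A F (algebraMap ℝ A (‖a‖ ^ 2)) z = ((‖a‖ ^ 2 : ℝ) : ℂ) • z := by
    have : algebraMap ℝ A (‖a‖ ^ 2) = algebraMap ℂ A ((‖a‖ ^ 2 : ℝ) : ℂ) := by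
      rw [Algebra.algebraMap_eq_smul_one, Algebra.algebraMap_eq_smul_one, Complex.coe_smul]
    rw [this, AlgHom.commutes]
    rfl
  rw [map_sub, LinearMap.sub_apply, h3, map_sub, map_smul, map_sub, smul_eq_mul] at h2
  have h4 : RCLike.re (((‖a‖ ^ 2 : ℝ) : ℂ) * form π F z z) = ‖a‖ ^ 2 * RCLike.re (form π F z z) :=
    RCLike.re_ofReal_mul _ _
  linarith

end PreHilbertTensor

namespace HilbertTensor

/-- The bounded operator `a ⊙ id` on `F ⊙ H`. -/
def leftOp (a : A) : HilbertTensor π F →L[ℂ] HilbertTensor π F :=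
  ((PreHilbertTensor.leftMul (B := B) π A F a).mkContinuous ‖a‖
    (PreHilbertTensor.norm_leftMul_le π A F a)).completion

theorem leftOp_coe (a : A) (z : PreHilbertTensor π F) :
    leftOp (B := B) π A F a (Completion.coe' z)
      = Completion.coe' (PreHilbertTensor.leftMul (B := B) π A F a z) :=
  ContinuousLinearMap.completion_apply_coe _ _

theorem op_ext {S T : HilbertTensor π F →L[ℂ] HilbertTensor π F}
    (h : ∀ z : PreHilbertTensor π F, S (Completion.coe' z) = T (Completion.coe' z)) : S = T := by
  ext z
  exact Completion.induction_on z (isClosed_eq S.continuous T.continuous) h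

theorem leftOp_adj (a : A) (z w : HilbertTensor π F) :
    inner ℂ (leftOp (B := B) π A F a z) w = inner ℂ z (leftOp (B := B) π A F (star a) w) := by
  refine Completion.induction_on₂ z w (isClosed_eq ?_ ?_) fun z w => ?_
  · exact Continuous.inner ((leftOp (B := B) π A F a).continuous.comp continuous_fst) continuous_snd
  · exact Continuous.inner continuous_fst
      ((leftOp (B := B) π A F (star a)).continuous.comp continuous_snd)
  · rw [leftOp_coe, leftOp_coe, Completion.inner_coe, Completion.inner_coe]
    exact PreHilbertTensor.form_leftMul π A F a z w

/-- The Stinespring representation `a ↦ a ⊙ id` of `A` on `F ⊙ H`. -/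
def leftRep : A →⋆ₐ[ℂ] (HilbertTensor π F →L[ℂ] HilbertTensor π F) where
  toFun a := leftOp (B := B) π A F a
  map_one' := op_ext π F fun z => by
    rw [leftOp_coe, map_one]; rfl
  map_mul' a b := op_ext π F fun z => by
    rw [mul_apply_eq_comp, leftOp_coe, leftOp_coe, leftOp_coe, map_mul]; rfl
  map_zero' := op_ext π F fun z => by
    rw [leftOp_coe, map_zero]; exact Completion.coe_zero
  map_add' a b := op_ext π F fun z => by
    rw [add_apply, leftOp_coe, leftOp_coe, leftOp_coe, map_add]
    exact Completion.coe_add _ _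
  commutes' c := op_ext π F fun z => by
    rw [leftOp_coe, AlgHom.commutes]
    exact Completion.coe_smul c z
  map_star' a := by
    rw [ContinuousLinearMap.star_eq_adjoint, ContinuousLinearMap.eq_adjoint_iff]
    intro z w
    rw [leftOp_adj, star_star]

variable {F} in
theorem leftRep_creation (a : A) (y : F) (h : H) :
    leftRep (B := B) π A F a (creation π y h) = creation π (a • y) h :=
  leftOp_coe π A F a _

end HilbertTensor

end leftRep

section kernels
/-! ### CPD-kernels and their representations -/

variable {B S E H : Type*} [CStarAlgebra B] [PartialOrder B] [StarOrderedRing B]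
  [NormedAddCommGroup E] [NormedSpace ℂ E] [Module Bᵐᵒᵖ E] [HilbertModule B E]
  [NormedAddCommGroup H] [InnerProductSpace ℂ H] [CompleteSpace H]

/-- Completely positive definite kernels over `S`, with values in the bounded maps on `B`. -/
def IsCPDKernel (𝔎 : S → S → (B →L[ℂ] B)) : Prop :=
  ∀ (n : ℕ) (σ : Fin n → S) (a b : Fin n → B),
    0 ≤ ∑ j, ∑ i, star (b j) * 𝔎 (σ j) (σ i) (star (a j) * a i) * b i

/-- Semigroups of CPD-kernels, composed pointwise. -/
structure IsCPDSemigroup {𝕋 : Type*} [AddCommMonoid 𝕋] (𝔎 : 𝕋 → S → S → (B →L[ℂ] B)) : Prop where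
  cpd : ∀ t, IsCPDKernel (𝔎 t)
  comp : ∀ s r σ σ', (𝔎 s σ σ').comp (𝔎 r σ σ') = 𝔎 (s + r) σ σ'

/-- `𝔎`-families of maps on `E`. -/
def IsKernelFamily (𝔎 : S → S → (B →L[ℂ] B)) (T : S → E → E) : Prop :=
  ∀ σ σ' y x, 𝔎 σ σ' (inner B y x) = inner B (T σ y) (T σ' x)

/-- `(F, η)` is a minimal Kolmogorov representation of `𝔎`. -/
structure IsMinimalKolmogorov {F : Type*} [NormedAddCommGroup F] [NormedSpace ℂ F]
    [Module Bᵐᵒᵖ F] [HilbertModule B F] [Module B F] [IsHilbertBimodule B B F]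
    (𝔎 : S → S → (B →L[ℂ] B)) (η : S → F) : Prop where
  kernel_eq : ∀ σ σ' b, 𝔎 σ σ' b = inner B (η σ) (b • η σ')
  total : (Submodule.span ℂ
    {y : F | ∃ (a : B) (σ : S) (b : B), op b • (a • η σ) = y}).topologicalClosure = ⊤

/-- `(K, ρ, L)` is a minimal Kolmogorov-Stinespring representation of `𝔎`, where `B` acts on `H`
through `π`. -/
structure IsMinimalStinespring {K : Type*} [NormedAddCommGroup K] [InnerProductSpace ℂ K]
    [CompleteSpace K] (π : B →⋆ₐ[ℂ] (H →L[ℂ] H)) (𝔎 : S → S → (B →L[ℂ] B))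
    (ρ : B →⋆ₐ[ℂ] (K →L[ℂ] K)) (L : S → (H →L[ℂ] K)) : Prop where
  kernel_eq : ∀ σ σ' b,
    (ContinuousLinearMap.adjoint (L σ)).comp ((ρ b).comp (L σ')) = π (𝔎 σ σ' b)
  total : (Submodule.span ℂ
    {k : K | ∃ (b : B) (σ : S) (h : H), ρ b (L σ h) = k}).topologicalClosure = ⊤

/-- `ξ : E → B(K, G)` is a (nondegenerate) representation of the Hilbert module `E` induced by the
representation `ρ` of `B` on `K`. -/
structure IsInducedRepresentation {K G : Type*} [NormedAddCommGroup K] [InnerProductSpace ℂ K]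
    [CompleteSpace K] [NormedAddCommGroup G] [InnerProductSpace ℂ G] [CompleteSpace G]
    (ρ : B →⋆ₐ[ℂ] (K →L[ℂ] K)) (ξ : E → (K →L[ℂ] G)) : Prop where
  isLinearMap : IsLinearMap ℂ ξ
  op_smul : ∀ (x : E) (b : B), ξ (op b • x) = (ξ x).comp (ρ b)
  adjoint_comp : ∀ x y, (ContinuousLinearMap.adjoint (ξ x)).comp (ξ y) = ρ (inner B x y)
  total : (Submodule.span ℂ {g : G | ∃ (x : E) (k : K), ξ x k = g}).topologicalClosure = ⊤

/-- Isometries between inner product modules: right linear and inner product preserving. -/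
structure IsModuleIsometry {X Y : Type*} [NormedAddCommGroup X] [NormedSpace ℂ X] [Module Bᵐᵒᵖ X]
    [HilbertModule B X] [NormedAddCommGroup Y] [NormedSpace ℂ Y] [Module Bᵐᵒᵖ Y]
    [HilbertModule B Y] (v : X →ₗ[ℂ] Y) : Prop where
  map_op_smul : ∀ (b : B) (z : X), v (op b • z) = op b • v z
  inner_map : ∀ z w : X, inner B (v z) (v w) = inner B z w

/-- `V = v ⊙ id_H` under the canonical identification `(E ⊙ F) ⊙ H = E ⊙ (F ⊙ H)`,
`(x ⊙ y) ⊙ h = x ⊙ (y ⊙ h)`. As the tensors `x ⊙ (y ⊙ h)` are total, this determines `V`. -/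
def IsAmplification {F : Type*} [NormedAddCommGroup F] [NormedSpace ℂ F]
    [Module Bᵐᵒᵖ F] [HilbertModule B F] [Module B F] [IsHilbertBimodule B B F]
    (π : B →⋆ₐ[ℂ] (H →L[ℂ] H)) (v : InteriorTensor B B E F →ₗ[ℂ] E)
    (V : HilbertTensor (HilbertTensor.leftRep π B F) E →L[ℂ] HilbertTensor π E) : Prop :=
  ∀ (x : E) (y : F) (h : H),
    V (HilbertTensor.creation (HilbertTensor.leftRep π B F) x (HilbertTensor.creation π y h))
      = HilbertTensor.creation π (v (InteriorTensor.tmul B B x y)) h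

end kernels

end

noncomputable section

section extension
/-! ### Isometries defined on total families -/

variable {ι X Y : Type*}

/-! Everything rests on one principle: if `u` is a total family and `w` is a family with the same
Gram matrix, then `u i ↦ w i` extends to an isometry. It is determined by these values, and it is
unitary when `w` is total as well. This holds for scalar Gram matrices
(`exists_linearIsometry_of_inner_eq`, `exists_linearIsometryEquiv_of_inner_eq`) and for `B`-valued
ones (`exists_moduleIsometry_of_inner_eq`).

Each claim then becomes a Gram matrix computation. In a Stinespring representation, the inner
products of the vectors `ρ b (L σ h)` depend only on the kernel (`IsMinimalStinespring.inner_eq`).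
In an induced representation, those of `ξ x k` depend only on `ρ` and the inner product of `E`. This
gives both uniqueness statements. For a kernel family, `x ⊙ η σ b` and `T σ x b` have the same Gram
entries `b⋆ 𝔎 σ σ' ⟨x, x'⟩ b'`, which produces `v`. Tensoring with `H` preserves Gram matrices,
which produces `V`.

Totality comes from moving algebra elements across tensor signs: `x ⊙ a y = x a ⊙ y`
(`InteriorTensor.tmul_smul_right`) and `x b ⊙ k = x ⊙ ρ b k` (`HilbertTensor.creation_op_smul`). In
`a η b ⊙ h` the right factor goes into `H`, and in `x ⊙ a η b` the left factor goes into `E`. The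
uniqueness of `V` is agreement of bounded operators on the total tensors `x ⊙ (η σ ⊙ h)`. -/

theorem dense_span_range_of_total {X : Type*} [NormedAddCommGroup X] [NormedSpace ℂ X]
    {s : Set X} {u : ι → X} (hs : (Submodule.span ℂ s).topologicalClosure = ⊤)
    (h : ∀ x ∈ s, x ∈ (Submodule.span ℂ (Set.range u)).topologicalClosure) :
    Dense (Submodule.span ℂ (Set.range u) : Set X) := by
  rw [Submodule.dense_iff_topologicalClosure_eq_top, eq_top_iff, ← hs]
  exact Submodule.topologicalClosure_minimal _ (Submodule.span_le.mpr h)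
    (Submodule.isClosed_topologicalClosure _)

/-- Equality of norms makes the assignment on linear combinations both well defined and isometric;
completeness of `Y` extends it from the dense span. Only norms enter, so the lemma serves Hilbert
spaces and Hilbert modules alike. -/
theorem exists_linearIsometry_of_norm_eq [NormedAddCommGroup X] [NormedSpace ℂ X]
    [NormedAddCommGroup Y] [NormedSpace ℂ Y] [CompleteSpace Y] {u : ι → X} {w : ι → Y}
    (hu : Dense (Submodule.span ℂ (Set.range u) : Set X))
    (h : ∀ c : ι →₀ ℂ,
      ‖Finsupp.linearCombination ℂ w c‖ = ‖Finsupp.linearCombination ℂ u c‖) :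
    ∃ T : X →ₗᵢ[ℂ] Y, ∀ i, T (u i) = w i := by
  have hd : DenseRange (Finsupp.linearCombination ℂ u) := by
    rwa [DenseRange, ← LinearMap.coe_range, Finsupp.range_linearCombination]
  have hb : ∃ C : ℝ, ∀ c, ‖Finsupp.linearCombination ℂ w c‖
      ≤ C * ‖Finsupp.linearCombination ℂ u c‖ := ⟨1, fun c => by rw [h, one_mul]⟩
  let T := (Finsupp.linearCombination ℂ w).extendOfNorm (Finsupp.linearCombination ℂ u)
  have hT : ∀ c, T (Finsupp.linearCombination ℂ u c) = Finsupp.linearCombination ℂ w c :=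
    LinearMap.extendOfNorm_eq hd hb
  refine ⟨⟨T.toLinearMap, fun x => ?_⟩, fun i => ?_⟩
  · refine hd.induction_on (p := fun x => ‖T x‖ = ‖x‖) x
      (isClosed_eq T.continuous.norm continuous_norm) fun c => ?_
    rw [hT, h]
  · simpa using hT (Finsupp.single i 1)

theorem exists_linearIsometry_of_inner_eq [NormedAddCommGroup X] [InnerProductSpace ℂ X]
    [NormedAddCommGroup Y] [InnerProductSpace ℂ Y] [CompleteSpace Y] {u : ι → X} {w : ι → Y}
    (hu : Dense (Submodule.span ℂ (Set.range u) : Set X))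
    (h : ∀ i j, inner ℂ (w i) (w j) = inner ℂ (u i) (u j)) :
    ∃ T : X →ₗᵢ[ℂ] Y, ∀ i, T (u i) = w i := by
  refine exists_linearIsometry_of_norm_eq hu fun c => ?_
  rw [← sq_eq_sq₀ (norm_nonneg _) (norm_nonneg _), ← inner_self_eq_norm_sq (𝕜 := ℂ),
    ← inner_self_eq_norm_sq (𝕜 := ℂ)]
  simp only [Finsupp.linearCombination_apply, Finsupp.sum, sum_inner, inner_sum,
    _root_.inner_smul_left, _root_.inner_smul_right, h]

/-- An isometry defined on a complete space has closed range, and this range contains the dense span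
of `w`, so it is everything. -/
theorem exists_linearIsometryEquiv_of_inner_eq [NormedAddCommGroup X] [InnerProductSpace ℂ X]
    [CompleteSpace X] [NormedAddCommGroup Y] [InnerProductSpace ℂ Y] [CompleteSpace Y]
    {u : ι → X} {w : ι → Y}
    (hu : Dense (Submodule.span ℂ (Set.range u) : Set X))
    (hw : Dense (Submodule.span ℂ (Set.range w) : Set Y))
    (h : ∀ i j, inner ℂ (w i) (w j) = inner ℂ (u i) (u j)) :
    ∃ T : X ≃ₗᵢ[ℂ] Y, ∀ i, T (u i) = w i := by
  obtain ⟨T, hT⟩ := exists_linearIsometry_of_inner_eq hu h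
  have hs : Function.Surjective T := by
    have hc : IsClosed (LinearMap.range T.toLinearMap : Set Y) :=
      T.isometry.isClosedEmbedding.isClosed_range
    have hle : Submodule.span ℂ (Set.range w) ≤ LinearMap.range T.toLinearMap := by
      rw [Submodule.span_le]
      rintro _ ⟨i, rfl⟩
      exact ⟨u i, hT i⟩
    intro y
    exact hc.closure_subset_iff.mpr hle (hw y)
  exact ⟨LinearIsometryEquiv.ofSurjective T hs, hT⟩

end extension

/-! ### Isometries of Hilbert modules and adjointable left actions -/

namespace HilbertModule

variable {B : Type*} [CStarAlgebra B] [PartialOrder B] [StarOrderedRing B]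

section isometry

variable {ι X Y : Type*}
  [NormedAddCommGroup X] [NormedSpace ℂ X] [Module Bᵐᵒᵖ X] [HilbertModule B X]
  [NormedAddCommGroup Y] [NormedSpace ℂ Y] [Module Bᵐᵒᵖ Y] [HilbertModule B Y]

theorem inner_sub_right (x y z : X) : inner B x (y - z) = inner B x y - inner B x z :=
  map_sub (form B X x) y z

theorem inner_sub_left (x y z : X) : inner B (x - y) z = inner B x z - inner B y z := by
  rw [← star_inner, inner_sub_right, star_sub, star_inner, star_inner]

variable (B) in
theorem eq_of_inner_sub_self {x y : X} (h : inner B (x - y) (x - y) = 0) : x = y := by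
  have h2 := norm_eq (B := B) (x - y)
  rw [h, norm_zero, Real.sqrt_zero, norm_eq_zero] at h2
  exact sub_eq_zero.mp h2

/-- An inner product preserving map is right linear. -/
theorem map_op_smul_of_inner_map {v : X → Y} (hv : ∀ z w, inner B (v z) (v w) = inner B z w)
    (b : B) (z : X) : v (op b • z) = op b • v z := by
  -- In the expansion of `⟨d, d⟩` for the difference `d` of the two sides, all four terms equal `b⋆
  -- ⟨z, z⟩ b` up to sign, and they cancel.
  refine eq_of_inner_sub_self B ?_
  simp only [inner_sub_left, inner_sub_right, inner_op_smul_right, inner_op_smul_left, hv]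
  simp [mul_assoc]

/-- The scalar argument works with `B`-valued Gram matrices because the norm comes from the inner
product. Preservation of inner products passes from combinations to limits by joint continuity, and
right linearity follows from it. Hence `u` need only be total for the complex span. -/
theorem exists_moduleIsometry_of_inner_eq [CompleteSpace Y] {u : ι → X} {w : ι → Y}
    (hu : Dense (Submodule.span ℂ (Set.range u) : Set X))
    (h : ∀ i j, inner B (w i) (w j) = inner B (u i) (u j)) :
    ∃ v : X →ₗᵢ[ℂ] Y, (∀ i, v (u i) = w i) ∧ IsModuleIsometry (B := B) v.toLinearMap := by
  have key : ∀ c d : ι →₀ ℂ,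
      inner B (Finsupp.linearCombination ℂ w c) (Finsupp.linearCombination ℂ w d)
        = inner B (Finsupp.linearCombination ℂ u c) (Finsupp.linearCombination ℂ u d) := by
    intro c d
    simp only [← form_apply, Finsupp.linearCombination_apply, Finsupp.sum, map_sum,
      LinearMap.sum_apply, LinearMap.map_smulₛₗ, LinearMap.smul_apply]
    simp only [form_apply, h]
  obtain ⟨v, hv⟩ := exists_linearIsometry_of_norm_eq (w := w) hu fun c => by
    rw [norm_eq (B := B) (Finsupp.linearCombination ℂ w c), key, ← norm_eq (B := B)]
  have hd : DenseRange (Finsupp.linearCombination ℂ u) := by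
    rwa [DenseRange, ← LinearMap.coe_range, Finsupp.range_linearCombination]
  have hvc : ∀ c, v (Finsupp.linearCombination ℂ u c) = Finsupp.linearCombination ℂ w c := by
    intro c
    simp only [Finsupp.linearCombination_apply, Finsupp.sum, map_sum, map_smul, hv]
  have hin : ∀ z z' : X, inner B (v z) (v z') = inner B z z' := by
    intro z z'
    refine hd.induction_on₂ (p := fun z z' => inner B (v z) (v z') = inner B z z') ?_
      (fun c d => by rw [hvc, hvc, key]) z z'
    exact isClosed_eq ((continuous_inner B Y).comp (v.continuous.prodMap v.continuous))
      (continuous_inner B X)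
  exact ⟨v, hv, map_op_smul_of_inner_map hin, hin⟩

end isometry

section bimodule

variable {A F : Type*} [CStarAlgebra A]
  [NormedAddCommGroup F] [NormedSpace ℂ F] [Module Bᵐᵒᵖ F] [HilbertModule B F]
  [Module A F] [IsHilbertBimodule A B F]

theorem inner_smul_right' (a : A) (x y : F) : inner B x (a • y) = inner B (star a • x) y := by
  rw [IsHilbertBimodule.inner_smul_left, star_star]

variable (B) in
-- An adjointable operator is automatically right linear: move `a` to the left slot as `a⋆`, pull
-- out `b`, and move `a` back.
theorem smul_op_smul (a : A) (b : B) (y : F) : a • (op b • y) = op b • (a • y) := by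
  refine ext_inner (B := B) fun z => ?_
  rw [inner_smul_right', inner_op_smul_right, inner_op_smul_right, inner_smul_right']

end bimodule

/-- Left multiplications are bounded. -/
theorem norm_left_smul_le {A F : Type*} (B : Type*) [CStarAlgebra B] [PartialOrder B]
    [StarOrderedRing B] [CStarAlgebra A] [NormedAddCommGroup F] [NormedSpace ℂ F] [Module Bᵐᵒᵖ F]
    [HilbertModule B F] [Module A F] [IsHilbertBimodule A B F] (a : A) (y : F) : ‖a • y‖ ≤ ‖a‖ * ‖y‖ := by
  -- `A` comes without an order, so the spectral order is used locally to write `‖a‖² - a⋆ a = c⋆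
  -- c`. Then `‖a‖² ⟨y, y⟩ - ⟨a y, a y⟩ = ⟨c y, c y⟩ ≥ 0`, and the norm is monotone on positive
  -- elements of `B`.
  let _ := CStarAlgebra.spectralOrder A
  have _ := CStarAlgebra.spectralOrderedRing A
  have h1 : 0 ≤ algebraMap ℝ A (‖a‖ ^ 2) - star a * a :=
    sub_nonneg.mpr CStarAlgebra.star_mul_le_algebraMap_norm_sq
  obtain ⟨c, hc⟩ := CStarAlgebra.nonneg_iff_eq_star_mul_self.mp h1
  have h2 := inner_self_nonneg (B := B) (c • y)
  have := IsHilbertBimodule.toIsScalarTower (A := A) (B := B) (F := F)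
  have h3 : algebraMap ℝ A (‖a‖ ^ 2) • y = ((‖a‖ ^ 2 : ℝ) : ℂ) • y := by
    rw [Algebra.algebraMap_eq_smul_one, ← Complex.coe_smul, smul_assoc, one_smul]
  rw [IsHilbertBimodule.inner_smul_left, smul_smul, ← hc, sub_smul, inner_sub_right, h3,
    HilbertModule.inner_smul_right, mul_smul, ← IsHilbertBimodule.inner_smul_left, sub_nonneg] at h2
  have h4 := CStarAlgebra.norm_le_norm_of_nonneg_of_le (inner_self_nonneg _) h2
  refine (sq_le_sq₀ (norm_nonneg _) (by positivity)).mp ?_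
  rw [mul_pow, norm_sq_eq (B := B) y, norm_sq_eq (B := B) (a • y)]
  refine h4.trans ?_
  rw [norm_smul, Complex.norm_real, norm_pow, norm_norm]

end HilbertModule

/-! ### Creation operators on `E ⊙ K` -/

namespace HilbertTensor

open HilbertModule

variable {B K E : Type*} [CStarAlgebra B] [PartialOrder B] [StarOrderedRing B]
  [NormedAddCommGroup K] [InnerProductSpace ℂ K] [CompleteSpace K]
  (ρ : B →⋆ₐ[ℂ] (K →L[ℂ] K))
  [NormedAddCommGroup E] [NormedSpace ℂ E] [Module Bᵐᵒᵖ E] [HilbertModule B E]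

theorem norm_creation_apply_le (x : E) (k : K) : ‖creation ρ x k‖ ≤ ‖x‖ * ‖k‖ := by
  change ‖Completion.coe' (PreHilbertTensor.tmul ρ x k)‖ ≤ ‖x‖ * ‖k‖
  rw [Completion.norm_coe]
  exact PreHilbertTensor.norm_tmul_le ρ E x k

theorem creation_add (x y : E) : creation ρ (x + y) = creation ρ x + creation ρ y := by
  ext k
  change Completion.coe' (PreHilbertTensor.tmul ρ (x + y) k) = _
  rw [add_apply]
  refine Eq.trans ?_ (Completion.coe_add _ _)
  exact congrArg _ (TensorProduct.tmul_add k x y)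

theorem creation_smul (c : ℂ) (x : E) : creation ρ (c • x) = c • creation ρ x := by
  ext k
  change Completion.coe' (PreHilbertTensor.tmul ρ (c • x) k) = _
  refine Eq.trans ?_ (Completion.coe_smul c (PreHilbertTensor.tmul ρ x k))
  exact congrArg _ (TensorProduct.tmul_smul c k x)

/-- The algebraic tensor product is taken over `ℂ`, so this balancing relation is not built in. It
holds in the completion because the difference of the two sides has length zero. -/
theorem creation_op_smul (x : E) (b : B) :
    creation ρ (op b • x) = (creation ρ x).comp (ρ b) := by
  ext k
  have hadj : ∀ (a : B) (k k' : K), inner ℂ (ρ a k) k' = inner ℂ k (ρ (star a) k') := by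
    intro a k k'
    rw [map_star, ContinuousLinearMap.star_eq_adjoint, ContinuousLinearMap.adjoint_inner_right]
  rw [← sub_eq_zero, ← inner_self_eq_zero (𝕜 := ℂ)]
  simp only [ContinuousLinearMap.comp_apply, _root_.inner_sub_left, _root_.inner_sub_right,
    inner_creation, inner_op_smul_left, inner_op_smul_right, map_mul, hadj,
    mul_apply_eq_comp]
  simp

/-- `x ↦ x ⊙ k` as a continuous map. -/
def creationFlip (k : K) : E →L[ℂ] HilbertTensor ρ E :=
  LinearMap.mkContinuous
    { toFun := fun x => creation ρ x k
      map_add' := fun x y => by rw [creation_add, add_apply]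
      map_smul' := fun c x => by
        rw [creation_smul]; rfl } ‖k‖ fun x => by
    rw [mul_comm]
    exact norm_creation_apply_le ρ x k

theorem adjoint_creation_comp (x y : E) :
    (ContinuousLinearMap.adjoint (creation ρ x)).comp (creation ρ y) = ρ (inner B x y) := by
  refine ContinuousLinearMap.ext fun k => ext_inner_left ℂ fun k' => ?_
  rw [ContinuousLinearMap.comp_apply, ContinuousLinearMap.adjoint_inner_right, inner_creation]

variable (E) in
theorem isInducedRepresentation_creation :
    IsInducedRepresentation ρ (fun x : E => creation ρ x) where
  isLinearMap := ⟨creation_add ρ, creation_smul ρ⟩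
  op_smul x b := creation_op_smul ρ x b
  adjoint_comp := adjoint_creation_comp ρ
  total := dense_span_creation ρ

end HilbertTensor

/-! ### Bounds, totality and balancing in `E ⊙ F` -/

namespace InteriorTensor

open HilbertModule

variable {B C E F : Type*} [CStarAlgebra B] [PartialOrder B] [StarOrderedRing B]
  [CStarAlgebra C] [PartialOrder C] [StarOrderedRing C]
  [NormedAddCommGroup E] [NormedSpace ℂ E] [Module Bᵐᵒᵖ E] [HilbertModule B E]
  [NormedAddCommGroup F] [NormedSpace ℂ F] [Module Cᵐᵒᵖ F] [HilbertModule C F]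
  [Module B F] [IsHilbertBimodule B C F]

theorem norm_tmul_le (x : E) (y : F) : ‖tmul B C x y‖ ≤ ‖x‖ * ‖y‖ := by
  refine (sq_le_sq₀ (norm_nonneg _) (by positivity)).mp ?_
  rw [norm_sq_eq (B := C), inner_tmul, mul_pow, norm_sq_eq (B := B) x]
  calc ‖inner C y (inner B x x • y)‖ ≤ ‖y‖ * ‖inner B x x • y‖ := norm_inner_le _ _
    _ ≤ ‖y‖ * (‖inner B x x‖ * ‖y‖) := by gcongr; exact norm_left_smul_le C _ _
    _ = ‖inner B x x‖ * ‖y‖ ^ 2 := by ring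

variable (B C) in
/-- `y ↦ x ⊙ y` as a continuous map. -/
def tmulRight (x : E) : F →L[ℂ] InteriorTensor B C E F :=
  LinearMap.mkContinuous
    { toFun := fun y => tmul B C x y
      map_add' := fun y y' => by
        refine Eq.trans ?_ (Completion.coe_add _ _)
        exact congrArg _ (TensorProduct.add_tmul y y' x)
      map_smul' := fun c y => by
        refine Eq.trans ?_ (Completion.coe_smul c (PreInteriorTensor.tmul B C x y))
        exact congrArg Completion.coe' (TensorProduct.smul_tmul' c y x).symm } ‖x‖ fun y => norm_tmul_le x y

variable (B C E F) in
theorem dense_span_tmul :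
    (Submodule.span ℂ {z : InteriorTensor B C E F |
      ∃ (x : E) (y : F), tmul B C x y = z}).topologicalClosure = ⊤ := by
  rw [← Submodule.dense_iff_topologicalClosure_eq_top]
  refine (Completion.denseRange_coe (α := PreInteriorTensor B C E F)).mono ?_
  rintro _ ⟨z, rfl⟩
  change F ⊗[ℂ] E at z
  induction z with
  | zero => exact Submodule.zero_mem (Submodule.span ℂ {z | ∃ (x : E) (y : F), tmul B C x y = z})
  | add z z' h h' =>
    rw [SetLike.mem_coe] at *
    have e := Completion.coe_add (α := PreInteriorTensor B C E F) z z'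
    exact (congrArg (· ∈ Submodule.span ℂ {z | ∃ (x : E) (y : F), tmul B C x y = z}) e).mpr
      (Submodule.add_mem _ h h')
  | tmul y x => exact Submodule.subset_span ⟨x, y, rfl⟩

/-- As for creation operators, balancing over `B` holds because the difference of the two sides has
inner square zero. -/
theorem tmul_smul_right (x : E) (b : B) (y : F) :
    tmul B C x (b • y) = tmul B C (op b • x) y := by
  refine eq_of_inner_sub_self C ?_
  simp only [HilbertModule.inner_sub_left, HilbertModule.inner_sub_right, inner_tmul,
    inner_op_smul_left, inner_op_smul_right, IsHilbertBimodule.inner_smul_left, smul_smul,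
    mul_assoc]
  simp

end InteriorTensor

/-- The preimage of a closed subspace is closed. Applied to `T = (x ⊙ ·)` or `T = (· ⊙ h)`, this
allows one tensor factor to be replaced by the members of a total set when totality of tensors is
checked. -/
theorem ContinuousLinearMap.apply_mem_of_total {X Y : Type*} [NormedAddCommGroup X]
    [NormedSpace ℂ X] [NormedAddCommGroup Y] [NormedSpace ℂ Y] (T : X →L[ℂ] Y) {s : Set X}
    (hs : (Submodule.span ℂ s).topologicalClosure = ⊤) {M : Submodule ℂ Y}
    (hM : IsClosed (M : Set Y)) (h : ∀ x ∈ s, T x ∈ M) (x : X) : T x ∈ M := by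
  have h1 : (Submodule.span ℂ s).topologicalClosure ≤ M.comap T.toLinearMap :=
    Submodule.topologicalClosure_minimal _ (Submodule.span_le.mpr h) (hM.preimage T.continuous)
  rw [hs] at h1
  exact h1 (Submodule.mem_top (x := x))

section dilation
/-! ### Kolmogorov and Stinespring representations, and kernel families -/

open HilbertModule HilbertTensor

variable {B S H : Type*} [CStarAlgebra B] [PartialOrder B] [StarOrderedRing B]
  [NormedAddCommGroup H] [InnerProductSpace ℂ H] [CompleteSpace H]
  {𝔎 : S → S → (B →L[ℂ] B)} (π : B →⋆ₐ[ℂ] (H →L[ℂ] H))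
  {E F : Type*} [NormedAddCommGroup E] [NormedSpace ℂ E] [Module Bᵐᵒᵖ E] [HilbertModule B E]
  [NormedAddCommGroup F] [NormedSpace ℂ F] [Module Bᵐᵒᵖ F] [HilbertModule B F]
  [Module B F] [IsHilbertBimodule B B F] {η : S → F}

/-- The kernel identity is the Kolmogorov identity sandwiched between vectors of `H`. Minimality
carries over because `a η b ⊙ h = ρ a (η ⊙ π b h)`: the right factor is absorbed by `H`, and the
left one is the action of `ρ`. -/
theorem IsMinimalKolmogorov.isMinimalStinespring (hη : IsMinimalKolmogorov 𝔎 η) :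
    IsMinimalStinespring π 𝔎 (leftRep π B F) (fun σ => creation π (η σ)) where
  kernel_eq σ σ' b := by
    refine ContinuousLinearMap.ext fun h => ext_inner_left ℂ fun h' => ?_
    rw [ContinuousLinearMap.comp_apply, ContinuousLinearMap.adjoint_inner_right,
      ContinuousLinearMap.comp_apply, leftRep_creation, inner_creation, hη.kernel_eq]
  total := by
    rw [eq_top_iff, ← dense_span_creation π (E := F)]
    refine Submodule.topologicalClosure_minimal _ (Submodule.span_le.mpr ?_)
      (Submodule.isClosed_topologicalClosure _)
    rintro _ ⟨y, h, rfl⟩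
    refine (creationFlip π h).apply_mem_of_total hη.total
      (Submodule.isClosed_topologicalClosure _) ?_ y
    rintro _ ⟨a, σ, b, rfl⟩
    refine Submodule.le_topologicalClosure _ (Submodule.subset_span ⟨a, σ, π b h, ?_⟩)
    rw [leftRep_creation]
    exact (congrArg (fun T => T h) (creation_op_smul π (a • η σ) b)).symm

/-- The right side does not mention `K`, `ρ` or `L`, so any two representations have equal Gram
matrices; this is the source of uniqueness. -/
theorem IsMinimalStinespring.inner_eq {K : Type*} [NormedAddCommGroup K] [InnerProductSpace ℂ K]
    [CompleteSpace K] {π : B →⋆ₐ[ℂ] (H →L[ℂ] H)} {ρ : B →⋆ₐ[ℂ] (K →L[ℂ] K)}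
    {L : S → (H →L[ℂ] K)} (hL : IsMinimalStinespring π 𝔎 ρ L) (b b' : B) (σ σ' : S) (h h' : H) :
    inner ℂ (ρ b (L σ h)) (ρ b' (L σ' h')) = inner ℂ h (π (𝔎 σ σ' (star b * b')) h') := by
  rw [← hL.kernel_eq, ContinuousLinearMap.comp_apply, ContinuousLinearMap.adjoint_inner_right,
    ContinuousLinearMap.comp_apply, map_mul, mul_apply_eq_comp, map_star,
    ContinuousLinearMap.star_eq_adjoint, ContinuousLinearMap.adjoint_inner_right]

/-- Minimal Kolmogorov-Stinespring representations are unique up to a unique unitary. -/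
theorem IsMinimalStinespring.existsUnique_linearIsometryEquiv {K K' : Type*}
    [NormedAddCommGroup K] [InnerProductSpace ℂ K] [CompleteSpace K]
    [NormedAddCommGroup K'] [InnerProductSpace ℂ K'] [CompleteSpace K']
    {π : B →⋆ₐ[ℂ] (H →L[ℂ] H)}
    {ρ : B →⋆ₐ[ℂ] (K →L[ℂ] K)} {L : S → (H →L[ℂ] K)}
    {ρ' : B →⋆ₐ[ℂ] (K' →L[ℂ] K')} {L' : S → (H →L[ℂ] K')}
    (hL : IsMinimalStinespring π 𝔎 ρ L) (hL' : IsMinimalStinespring π 𝔎 ρ' L') :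
    ∃! U : K ≃ₗᵢ[ℂ] K', (∀ σ h, U (L σ h) = L' σ h) ∧ ∀ b k, U (ρ b k) = ρ' b (U k) := by
  let u : B × S × H → K := fun p => ρ p.1 (L p.2.1 p.2.2)
  let w : B × S × H → K' := fun p => ρ' p.1 (L' p.2.1 p.2.2)
  have hu : Dense (Submodule.span ℂ (Set.range u) : Set K) := by
    refine dense_span_range_of_total hL.total ?_
    rintro _ ⟨b, σ, h, rfl⟩
    exact Submodule.le_topologicalClosure _ (Submodule.subset_span ⟨(b, σ, h), rfl⟩)
  have hw : Dense (Submodule.span ℂ (Set.range w) : Set K') := by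
    refine dense_span_range_of_total hL'.total ?_
    rintro _ ⟨b, σ, h, rfl⟩
    exact Submodule.le_topologicalClosure _ (Submodule.subset_span ⟨(b, σ, h), rfl⟩)
  obtain ⟨U, hU⟩ := exists_linearIsometryEquiv_of_inner_eq hu hw fun i j =>
    (hL'.inner_eq _ _ _ _ _ _).trans (hL.inner_eq _ _ _ _ _ _).symm
  refine ⟨U, ⟨fun σ h => ?_, fun b k => ?_⟩, ?_⟩
  -- The index `b = 1` recovers `L σ h`, since `ρ` is unital.
  · simpa [u, w] using hU (1, σ, h)
  · have : U.toContinuousLinearEquiv.toContinuousLinearMap.comp (ρ b)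
        = (ρ' b).comp U.toContinuousLinearEquiv.toContinuousLinearMap := by
      refine ContinuousLinearMap.ext_on hu ?_
      rintro _ ⟨⟨a, σ, h⟩, rfl⟩
      -- The algebra acts on both total families by the same shift of indices `(a, σ, h) ↦ (b a, σ,
      -- h)`, so `U` intertwines the representations there, hence everywhere.
      have h1 : ρ b (u (a, σ, h)) = u (b * a, σ, h) := by simp [u]
      have h2 : ρ' b (w (a, σ, h)) = w (b * a, σ, h) := by simp [w]
      change U (ρ b (u (a, σ, h))) = ρ' b (U (u (a, σ, h)))
      rw [h1, hU, hU, h2]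
    exact congrArg (fun T => T k) this
  · rintro W ⟨hW, hW'⟩
    have : W.toContinuousLinearEquiv.toContinuousLinearMap
        = U.toContinuousLinearEquiv.toContinuousLinearMap := by
      refine ContinuousLinearMap.ext_on hu ?_
      rintro _ ⟨⟨a, σ, h⟩, rfl⟩
      change W (u (a, σ, h)) = U (u (a, σ, h))
      rw [hU]
      -- Intertwining together with the values on `L σ h` fixes `W` on the whole total family.
      change W (ρ a (L σ h)) = _
      rw [hW', hW]
    ext k
    exact congrArg (fun T => T k) this

/-- Induced representations are unique up to a unique unitary. -/
theorem IsInducedRepresentation.existsUnique_linearIsometryEquiv {K G G' : Type*}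
    [NormedAddCommGroup K] [InnerProductSpace ℂ K] [CompleteSpace K]
    [NormedAddCommGroup G] [InnerProductSpace ℂ G] [CompleteSpace G]
    [NormedAddCommGroup G'] [InnerProductSpace ℂ G'] [CompleteSpace G']
    {ρ : B →⋆ₐ[ℂ] (K →L[ℂ] K)} {ξ : E → (K →L[ℂ] G)} {ξ' : E → (K →L[ℂ] G')}
    (hξ : IsInducedRepresentation ρ ξ) (hξ' : IsInducedRepresentation ρ ξ') :
    ∃! U : G ≃ₗᵢ[ℂ] G', ∀ x k, U (ξ x k) = ξ' x k := by
  let u : E × K → G := fun p => ξ p.1 p.2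
  let w : E × K → G' := fun p => ξ' p.1 p.2
  have hu : Dense (Submodule.span ℂ (Set.range u) : Set G) := by
    refine dense_span_range_of_total hξ.total ?_
    rintro _ ⟨x, k, rfl⟩
    exact Submodule.le_topologicalClosure _ (Submodule.subset_span ⟨(x, k), rfl⟩)
  have hw : Dense (Submodule.span ℂ (Set.range w) : Set G') := by
    refine dense_span_range_of_total hξ'.total ?_
    rintro _ ⟨x, k, rfl⟩
    exact Submodule.le_topologicalClosure _ (Submodule.subset_span ⟨(x, k), rfl⟩)
  -- Both Gram entries equal `⟨k, ρ ⟨x, y⟩ k'⟩`.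
  obtain ⟨U, hU⟩ := exists_linearIsometryEquiv_of_inner_eq hu hw fun i j => by
    change inner ℂ (ξ' i.1 i.2) (ξ' j.1 j.2) = inner ℂ (ξ i.1 i.2) (ξ j.1 j.2)
    rw [← ContinuousLinearMap.adjoint_inner_right, ← ContinuousLinearMap.adjoint_inner_right,
      ← ContinuousLinearMap.comp_apply, ← ContinuousLinearMap.comp_apply, hξ.adjoint_comp,
      hξ'.adjoint_comp]
  refine ⟨U, fun x k => hU (x, k), fun W hW => ?_⟩
  have : W.toContinuousLinearEquiv.toContinuousLinearMap
      = U.toContinuousLinearEquiv.toContinuousLinearMap := by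
    refine ContinuousLinearMap.ext_on hu ?_
    rintro _ ⟨⟨x, k⟩, rfl⟩
    exact (hW x k).trans (hU (x, k)).symm
  ext g
  exact congrArg (fun T => T g) this

variable (E) in
/-- The tensors `x ⊙ (η σ ⊙ h)` are total. -/
theorem IsMinimalKolmogorov.dense_span_creation_creation (hη : IsMinimalKolmogorov 𝔎 η) :
    Dense (Submodule.span ℂ (Set.range fun p : E × S × H =>
      creation (leftRep π B F) p.1 (creation π (η p.2.1) p.2.2)) :
        Set (HilbertTensor (leftRep π B F) E)) := by
  refine dense_span_range_of_total (dense_span_creation (leftRep π B F)) ?_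
  rintro _ ⟨x, k, rfl⟩
  refine (creation (leftRep π B F) x).apply_mem_of_total (hη.isMinimalStinespring π).total
    (Submodule.isClosed_topologicalClosure _) ?_ k
  rintro _ ⟨b, σ, h, rfl⟩
  -- The operator `ρ b` is moved across the tensor sign onto `x`.
  refine Submodule.le_topologicalClosure _ (Submodule.subset_span ⟨(op b • x, σ, h), ?_⟩)
  exact congrArg (fun T => T (creation π (η σ) h)) (creation_op_smul (leftRep π B F) x b)

variable (E) in
/-- The tensors `x ⊙ η σ b` are total. -/
theorem IsMinimalKolmogorov.dense_span_tmul (hη : IsMinimalKolmogorov 𝔎 η) :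
    Dense (Submodule.span ℂ (Set.range fun p : E × S × B =>
      InteriorTensor.tmul B B p.1 (op p.2.2 • η p.2.1)) : Set (InteriorTensor B B E F)) := by
  refine dense_span_range_of_total (InteriorTensor.dense_span_tmul B B E F) ?_
  rintro _ ⟨x, y, rfl⟩
  refine (InteriorTensor.tmulRight B B x).apply_mem_of_total hη.total
    (Submodule.isClosed_topologicalClosure _) ?_ y
  rintro _ ⟨a, σ, b, rfl⟩
  -- The left factor `a` is absorbed by `x`. The right factor `b` stays in the index, because the
  -- span is only complex linear.
  refine Submodule.le_topologicalClosure _ (Submodule.subset_span ⟨(op a • x, σ, b), ?_⟩)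
  change _ = InteriorTensor.tmul B B x (op b • (a • η σ))
  rw [← smul_op_smul B, InteriorTensor.tmul_smul_right]

/-- A `𝔎`-family on `E` gives an isometry `E ⊙ F → E`, `x ⊙ η σ ↦ T σ x`. -/
theorem IsKernelFamily.exists_moduleIsometry [CompleteSpace E] (hη : IsMinimalKolmogorov 𝔎 η)
    {T : S → E → E} (hT : IsKernelFamily 𝔎 T) :
    ∃ v : InteriorTensor B B E F →ₗ[ℂ] E, IsModuleIsometry (B := B) v ∧
      ∀ σ x, v (InteriorTensor.tmul B B x (η σ)) = T σ x := by
  -- Both Gram entries equal `b⋆ 𝔎 σ σ' ⟨x, x'⟩ b'`: on the left by the family identity, on the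
  -- right by the Kolmogorov identity.
  obtain ⟨v, hv, hiso⟩ := exists_moduleIsometry_of_inner_eq (B := B)
    (w := fun p : E × S × B => op p.2.2 • T p.2.1 p.1) (hη.dense_span_tmul E) (by
      rintro ⟨x, σ, b⟩ ⟨x', σ', b'⟩
      rw [InteriorTensor.inner_tmul, smul_op_smul B, inner_op_smul_left, inner_op_smul_right,
        inner_op_smul_left, inner_op_smul_right, ← hT, hη.kernel_eq])
  exact ⟨v.toLinearMap, hiso, fun σ x => by simpa using hv (x, σ, 1)⟩

/-- Module isometries `E ⊙ F → E` amplify to isometries `E ⊙ F ⊙ H → E ⊙ H`. -/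
theorem IsModuleIsometry.exists_amplification {v : InteriorTensor B B E F →ₗ[ℂ] E}
    (hv : IsModuleIsometry (B := B) v) :
    ∃ V : HilbertTensor (leftRep π B F) E →ₗᵢ[ℂ] HilbertTensor π E,
      IsAmplification π v V.toContinuousLinearMap := by
  -- `V` is built directly on `E ⊙ (F ⊙ H)`, so no associativity isomorphism is needed. Both Gram
  -- entries reduce to `⟨h, π ⟨y, ⟨x, x'⟩ y'⟩ h'⟩`.
  obtain ⟨V, hV⟩ := exists_linearIsometry_of_inner_eq
    (u := fun p : E × F × H => creation (leftRep π B F) p.1 (creation π p.2.1 p.2.2))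
    (w := fun p : E × F × H => creation π (v (InteriorTensor.tmul B B p.1 p.2.1)) p.2.2) (by
      refine dense_span_range_of_total (dense_span_creation (leftRep π B F)) ?_
      rintro _ ⟨x, k, rfl⟩
      refine (creation (leftRep π B F) x).apply_mem_of_total (dense_span_creation π (E := F))
        (Submodule.isClosed_topologicalClosure _) ?_ k
      rintro _ ⟨y, h, rfl⟩
      exact Submodule.le_topologicalClosure _ (Submodule.subset_span ⟨(x, y, h), rfl⟩)) (by
      rintro ⟨x, y, h⟩ ⟨x', y', h'⟩
      rw [inner_creation, inner_creation, leftRep_creation, inner_creation, hv.inner_map,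
        InteriorTensor.inner_tmul])
  exact ⟨V, fun x y h => hV (x, y, h)⟩

end dilation

end

/-! ### The main theorem -/

theorem mainTheorem7
    {𝕋 : Type*} [AddCommMonoid 𝕋] {S : Type*}
    {H : Type*} [NormedAddCommGroup H] [InnerProductSpace ℂ H] [CompleteSpace H]
    {B : Type*} [CStarAlgebra B] [PartialOrder B] [StarOrderedRing B]
    (π : B →⋆ₐ[ℂ] (H →L[ℂ] H)) (hπ : Function.Injective π)
    {E : Type*} [NormedAddCommGroup E] [NormedSpace ℂ E] [CompleteSpace E]
    [Module Bᵐᵒᵖ E] [HilbertModule B E]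
    (𝔎 : 𝕋 → S → S → (B →L[ℂ] B)) (h𝔎 : IsCPDSemigroup 𝔎)
    (F : 𝕋 → Type*) [∀ t, NormedAddCommGroup (F t)] [∀ t, NormedSpace ℂ (F t)]
    [∀ t, CompleteSpace (F t)] [∀ t, Module Bᵐᵒᵖ (F t)] [∀ t, HilbertModule B (F t)]
    [∀ t, Module B (F t)] [∀ t, IsHilbertBimodule B B (F t)]
    (η : ∀ t, S → F t) (hη : ∀ t, IsMinimalKolmogorov (𝔎 t) (η t))
    (𝒦 : 𝕋 → S → (E →ₗ[ℂ] E)) (h𝒦 : ∀ t, IsKernelFamily (𝔎 t) (fun σ => 𝒦 t σ)) :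
    (∀ t, IsMinimalStinespring π (𝔎 t) (HilbertTensor.leftRep π B (F t))
        (fun σ => HilbertTensor.creation π (η t σ))) ∧
    (∀ t (K' : Type*) [NormedAddCommGroup K'] [InnerProductSpace ℂ K'] [CompleteSpace K']
        (ρ' : B →⋆ₐ[ℂ] (K' →L[ℂ] K')) (L' : S → (H →L[ℂ] K')),
        IsMinimalStinespring π (𝔎 t) ρ' L' →
        ∃! U : HilbertTensor π (F t) ≃ₗᵢ[ℂ] K',
          (∀ σ h, U (HilbertTensor.creation π (η t σ) h) = L' σ h) ∧
          ∀ b k, U (HilbertTensor.leftRep π B (F t) b k) = ρ' b (U k)) ∧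
    (∀ t, IsInducedRepresentation (HilbertTensor.leftRep π B (F t))
        (fun x : E => HilbertTensor.creation (HilbertTensor.leftRep π B (F t)) x)) ∧
    (∀ t (G' : Type*) [NormedAddCommGroup G'] [InnerProductSpace ℂ G'] [CompleteSpace G']
        (ξ' : E → (HilbertTensor π (F t) →L[ℂ] G')),
        IsInducedRepresentation (HilbertTensor.leftRep π B (F t)) ξ' →
        ∃! U : HilbertTensor (HilbertTensor.leftRep π B (F t)) E ≃ₗᵢ[ℂ] G',
          ∀ x k, U (HilbertTensor.creation (HilbertTensor.leftRep π B (F t)) x k) = ξ' x k) ∧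
    IsInducedRepresentation π (fun x : E => HilbertTensor.creation π x) ∧
    ∃ (v : ∀ t, InteriorTensor B B E (F t) →ₗ[ℂ] E)
      (V : ∀ t, HilbertTensor (HilbertTensor.leftRep π B (F t)) E →ₗᵢ[ℂ] HilbertTensor π E),
      (∀ t, IsModuleIsometry (B := B) (v t)) ∧
      (∀ t σ x, v t (InteriorTensor.tmul B B x (η t σ)) = 𝒦 t σ x) ∧
      (∀ t, IsAmplification π (v t) (V t).toContinuousLinearMap) ∧
      (∀ t σ x,
        ((V t).toContinuousLinearMap.comp
          (HilbertTensor.creation (HilbertTensor.leftRep π B (F t)) x)).comp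
            (HilbertTensor.creation π (η t σ)) = HilbertTensor.creation π (𝒦 t σ x)) ∧
      (∀ t (W : HilbertTensor (HilbertTensor.leftRep π B (F t)) E →L[ℂ] HilbertTensor π E),
        (∀ σ x, (W.comp (HilbertTensor.creation (HilbertTensor.leftRep π B (F t)) x)).comp
            (HilbertTensor.creation π (η t σ)) = HilbertTensor.creation π (𝒦 t σ x)) →
        W = (V t).toContinuousLinearMap) ∧
      (∀ s t σ x,
        ((V (s + t)).toContinuousLinearMap.comp
          (HilbertTensor.creation (HilbertTensor.leftRep π B (F (s + t))) x)).comp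
            (HilbertTensor.creation π (η (s + t) σ)) = HilbertTensor.creation π (𝒦 (s + t) σ x)) ∧
      (∀ s t, (∀ σ x, 𝒦 (s + t) σ x = 𝒦 s σ (𝒦 t σ x)) → ∀ σ x,
        ((V (s + t)).toContinuousLinearMap.comp
          (HilbertTensor.creation (HilbertTensor.leftRep π B (F (s + t))) x)).comp
            (HilbertTensor.creation π (η (s + t) σ)) =
        ((V s).toContinuousLinearMap.comp
          (HilbertTensor.creation (HilbertTensor.leftRep π B (F s))
            (v t (InteriorTensor.tmul B B x (η t σ))))).comp
            (HilbertTensor.creation π (η s σ))) := by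
  choose v hv hvη using fun t => (h𝒦 t).exists_moduleIsometry (hη t)
  choose V hV using fun t => (hv t).exists_amplification π
  have hVη : ∀ t σ x, ((V t).toContinuousLinearMap.comp
      (HilbertTensor.creation (HilbertTensor.leftRep π B (F t)) x)).comp
        (HilbertTensor.creation π (η t σ)) = HilbertTensor.creation π (𝒦 t σ x) := by
    intro t σ x
    ext h
    exact (hV t x (η t σ) h).trans (by rw [hvη])
  refine ⟨fun t => (hη t).isMinimalStinespring π,
    fun t K' _ _ _ ρ' L' h' =>
      ((hη t).isMinimalStinespring π).existsUnique_linearIsometryEquiv h',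
    fun t => HilbertTensor.isInducedRepresentation_creation E _,
    fun t G' _ _ _ ξ' h' =>
      (HilbertTensor.isInducedRepresentation_creation E _).existsUnique_linearIsometryEquiv h',
    HilbertTensor.isInducedRepresentation_creation E π, v, V, hv, hvη, hV, hVη, fun t W hW => ?_,
    fun s t => hVη (s + t), fun s t hst σ x => ?_⟩
  -- The prescribed identity fixes a bounded operator on the total tensors `x ⊙ (η σ ⊙ h)`.
  · refine ContinuousLinearMap.ext_on ((hη t).dense_span_creation_creation π E) ?_
    rintro _ ⟨⟨x, σ, h⟩, rfl⟩
    exact congrArg (fun T => T h) ((hW σ x).trans (hVη t σ x).symm)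
  -- The formula at `s + t` gives `𝒦 (s + t) σ x`. The formula at `s`, applied to the vector `v t (x
  -- ⊙ η t σ) = 𝒦 t σ x`, gives `𝒦 s σ (𝒦 t σ x)`.
  · rw [hVη, hVη, hvη, hst]
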